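/- There is an absolute constant $C$ such that the following holds. Let $P$ be a simple $d$-dimensional polytope with $n$ facets, where $n-d=2$ (simple: every vertex lies on exactly $d$ facets). Let the edges of $P$ be oriented by an arbitrary unique sink orientation, i.e. an orientation for which every non-empty face $F$ of $P$ (including $P$ itself) contains exactly one vertex that has no outgoing edge inside $F$. Consider the directed random walk on $P$ that starts at an arbitrary vertex $v_0$ and, as long as the current vertex has an outgoing edge, moves along an outgoing edge chosen uniformly at random, independently of the past given the current vertex. Then the expected number of steps until the walk arrives at the unique sink of $P$ is at most $C\log^2 n$. -/

import Mathlib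

open Set MeasureTheory
open scoped ENNReal

noncomputable section

namespace Polytope

variable {E : Type*} [NormedAddCommGroup E] [NormedSpace ℝ E]

/-- A (convex) polytope: a bounded intersection of finitely many closed halfspaces. -/
def IsPolytope (P : Set E) : Prop :=
  Bornology.IsBounded P ∧
    ∃ (k : ℕ) (a : Fin k → StrongDual ℝ E) (b : Fin k → ℝ), P = {x | ∀ i, a i x ≤ b i}

/-- The affine dimension of a set (used for nonempty sets). -/
def dim (P : Set E) : ℕ := Module.finrank ℝ (vectorSpan ℝ P)

/-- The nonempty faces of `P`: the nonempty sets of maximizers over `P` of a linear functional.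
The zero functional shows that a nonempty `P` is a face of itself. -/
def IsFace (P F : Set E) : Prop := F.Nonempty ∧ IsExposed ℝ P F

/-- A facet is a face of codimension one. -/
def IsFacet (P F : Set E) : Prop := IsFace P F ∧ dim F + 1 = dim P

/-- The type of vertices of `P`. -/
abbrev Vertex (P : Set E) : Type _ := {v : E // v ∈ P.extremePoints ℝ}

/-- `P` is simple if every vertex lies on exactly `dim P` facets. -/
def IsSimple (P : Set E) : Prop :=
  ∀ v : Vertex P, {F | IsFacet P F ∧ (v : E) ∈ F}.ncard = dim P

/-- The graph of `P`: two distinct vertices are adjacent if the segment between them is a face. -/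
def graph (P : Set E) : SimpleGraph (Vertex P) where
  Adj u v := u ≠ v ∧ IsFace P (segment ℝ (u : E) v)
  symm := ⟨fun u v h => ⟨h.1.symm, by rw [segment_symm]; exact h.2⟩⟩
  loopless := ⟨fun _ h => h.1 rfl⟩

/-- `R` is an orientation of the edges of `G`: it relates only adjacent vertices, and every edge
gets exactly one of its two directions. -/
def IsOrientation {V : Type*} (G : SimpleGraph V) (R : V → V → Prop) : Prop :=
  (∀ u v, R u v → G.Adj u v) ∧ ∀ u v, G.Adj u v → (R u v ↔ ¬ R v u)

/-- A unique sink orientation of `P`: an orientation of the graph of `P` such that in every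
nonempty face `F` there is exactly one vertex without outgoing edges inside `F`. -/
def IsUniqueSinkOrientation (P : Set E) (R : Vertex P → Vertex P → Prop) : Prop :=
  IsOrientation (graph P) R ∧
    ∀ F, IsFace P F → ∃! v : Vertex P, (v : E) ∈ F ∧ ∀ w : Vertex P, (w : E) ∈ F → ¬ R v w

end Polytope

namespace DirectedWalk

variable {V : Type*}

/-- A vertex without outgoing edges. -/
def IsSink (R : V → V → Prop) (v : V) : Prop := ∀ w, ¬ R v w

open Classical in
/-- Transition probabilities of the directed random walk: uniform on the out-neighbours of `u`;
at a sink the walk has terminated and stays put. -/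
def stepProb (R : V → V → Prop) (u v : V) : ℝ≥0∞ :=
  if IsSink R u then (if v = u then 1 else 0)
  else if R u v then ({w | R u w}.ncard : ℝ≥0∞)⁻¹ else 0

/-- `X 0, X 1, …` is a directed random walk along `R` started at `v₀`: given the positions
up to time `k`, the position at time `k + 1` is distributed according to `stepProb`. -/
structure IsDirectedRandomWalk {Ω : Type*} [MeasurableSpace Ω] (μ : Measure Ω)
    (R : V → V → Prop) (v₀ : V) (X : ℕ → Ω → V) : Prop where
  measurableSet_eq : ∀ k v, MeasurableSet {ω | X k ω = v}
  start : ∀ᵐ ω ∂μ, X 0 ω = v₀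
  step : ∀ (k : ℕ) (x : ℕ → V),
    μ {ω | ∀ i ≤ k + 1, X i ω = x i} =
      μ {ω | ∀ i ≤ k, X i ω = x i} * stepProb R (x k) (x (k + 1))

/-- The number of steps after which the trajectory `x` first arrives at a sink
(`∞` if it never does). -/
def stepsToSink (R : V → V → Prop) (x : ℕ → V) : ℝ≥0∞ :=
  ⨅ (k : ℕ) (_ : IsSink R (x k)), (k : ℝ≥0∞)

end DirectedWalk

end

/-! A vertex of a simple polytope with `dim P + 2` facets misses exactly two facets, and the missed
pairs form a complete bipartite graph on the facets (`Description.coAdj_triple`,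
`Description.exists_equiv`). So the vertices form a grid in which two vertices are adjacent when
they share a coordinate. Every subgrid is cut out by a face, so the orientation has exactly one sink
in each subgrid.

Two facts about such orientations carry the analysis. By double counting over subgrids with one line
removed, each admissible pair of out-degrees, one per direction, occurs exactly once in every
subgrid (`IsUSO.indexCount_eq_one`). Moreover the orientation is acyclic (`IsUSO.acyclic`). Since
`(i₀, j₀)` is the sink of the subgrid that avoids the lines of its out-neighbours, and every vertex
of that subgrid leads back to it, a walk from `(i₀, j₀)` never returns to that subgrid
(`IsUSO.mem_or_mem_of_transGen`).

The expected number of steps `E` is bounded scale by scale. Suppose that `E ≤ F` wherever both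
out-degrees are below `m`, and start where both are below `2 * m`. Let `F + H` be the maximum of `E`
over the reachable vertices, with `H > 0`. The truncated difference between this maximum and `E` is
a `Gain`: it is `H` at the vertices of the smaller scale and `0` at the maximizer. It therefore
suffices that every reachable vertex has gain at least a constant multiple of `H` up to `O(log n)`;
in terms of the walk, the smaller scale is hit with constant probability after logarithmically many
steps.

This rests on runs along a single line (`Gain.sum_le_of_run`) and on a count of targets for vertices
with both out-degrees at most `4 * m` (`IsUSO.sq_le_two_mul_sum_weight`, `Gain.le_of_le`);
confinement extends the bound to all reachable vertices (`Gain.le_sixteen_mul`). Doubling `m` about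
`log n` times gives the square of the logarithm, and a telescoping sum transfers the bound to the
random process. -/

/-- Orientation data of the rook's graph on `α × β`: `col j i i'` says that the edge between
`(i, j)` and `(i', j)` is directed to `(i', j)`; `row i j j'` says that the edge between
`(i, j)` and `(i, j')` is directed to `(i, j')`. -/
structure GridOrientation (α β : Type*) where
  /-- The edges that change the first coordinate. -/
  col : β → α → α → Prop
  /-- The edges that change the second coordinate. -/
  row : α → β → β → Prop

/-! ### Grid orientations and the distribution of out-degrees. -/

namespace GridOrientation

open Classical Finset

variable {α β : Type*}

/-- Exchange the two coordinates. -/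
def swap (G : GridOrientation α β) : GridOrientation β α := ⟨G.row, G.col⟩

/-- `(i, j)` has no outgoing edge inside the subgrid `A × B`. -/
def IsSinkIn (G : GridOrientation α β) (A : Finset α) (B : Finset β) (i : α) (j : β) : Prop :=
  (∀ x ∈ A, ¬ G.col j i x) ∧ ∀ y ∈ B, ¬ G.row i j y

/-- Unique sink orientations of a grid: every subgrid has exactly one sink. -/
structure IsUSO (G : GridOrientation α β) : Prop where
  col_irrefl : ∀ j i, ¬ G.col j i i
  row_irrefl : ∀ i j, ¬ G.row i j j
  col_iff : ∀ j i i', i ≠ i' → (G.col j i i' ↔ ¬ G.col j i' i)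
  row_iff : ∀ i j j', j ≠ j' → (G.row i j j' ↔ ¬ G.row i j' j)
  exists_unique_sink : ∀ (A : Finset α) (B : Finset β), A.Nonempty → B.Nonempty →
    ∃! p : α × β, (p.1 ∈ A ∧ p.2 ∈ B) ∧ G.IsSinkIn A B p.1 p.2

variable {G : GridOrientation α β}

theorem IsUSO.swap (h : G.IsUSO) : G.swap.IsUSO where
  col_irrefl := h.row_irrefl
  row_irrefl := h.col_irrefl
  col_iff := h.row_iff
  row_iff := h.col_iff
  exists_unique_sink A B hA hB := by
    obtain ⟨p, ⟨⟨hp1, hp2⟩, hp3, hp4⟩, hp⟩ := h.exists_unique_sink B A hB hA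
    refine ⟨p.swap, ⟨⟨hp2, hp1⟩, hp4, hp3⟩, ?_⟩
    rintro ⟨y, x⟩ ⟨⟨h1, h2⟩, h3, h4⟩
    have := hp (x, y) ⟨⟨h2, h1⟩, h4, h3⟩
    rw [← this]; rfl

theorem IsUSO.col_asymm (h : G.IsUSO) {j i i'} (h1 : G.col j i i') : ¬ G.col j i' i := by
  rcases eq_or_ne i i' with rfl | hne
  · exact h.col_irrefl _ _
  · exact (h.col_iff j i i' hne).1 h1

theorem IsUSO.row_asymm (h : G.IsUSO) {i j j'} (h1 : G.row i j j') : ¬ G.row i j' j :=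
  h.swap.col_asymm h1

theorem IsUSO.col_total (h : G.IsUSO) {j i i'} (hne : i ≠ i') (h1 : ¬ G.col j i i') :
    G.col j i' i := by
  by_contra h2
  exact h1 ((h.col_iff j i i' hne).2 h2)

theorem IsUSO.row_total (h : G.IsUSO) {i j j'} (hne : j ≠ j') (h1 : ¬ G.row i j j') :
    G.row i j' j := h.swap.col_total hne h1

theorem IsUSO.sink_eq (h : G.IsUSO) {A : Finset α} {B : Finset β} {i i' j j'}
    (hi : i ∈ A) (hj : j ∈ B) (hi' : i' ∈ A) (hj' : j' ∈ B)
    (h1 : G.IsSinkIn A B i j) (h2 : G.IsSinkIn A B i' j') : i = i' ∧ j = j' := by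
  obtain ⟨p, -, hp⟩ := h.exists_unique_sink A B ⟨i, hi⟩ ⟨j, hj⟩
  have e1 := hp (i, j) ⟨⟨hi, hj⟩, h1⟩
  have e2 := hp (i', j') ⟨⟨hi', hj'⟩, h2⟩
  rw [← e2] at e1
  exact Prod.ext_iff.1 e1

/-- A directed triangle inside a line would be a subgrid without a sink. Hence every line is
linearly ordered by its orientation. -/
theorem IsUSO.col_trans (h : G.IsUSO) {j x y z} (h1 : G.col j x y) (h2 : G.col j y z) :
    G.col j x z := by
  by_contra h3
  have hxz : x ≠ z := by rintro rfl; exact h.col_asymm h1 h2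
  have h4 := h.col_total hxz h3
  obtain ⟨⟨i, j'⟩, ⟨⟨hi, hj⟩, hs, -⟩, -⟩ := h.exists_unique_sink {x, y, z} {j} (by simp) (by simp)
  simp only [Finset.mem_insert, Finset.mem_singleton] at hi hj hs
  subst hj
  rcases hi with rfl | rfl | rfl
  · exact hs y (by simp) h1
  · exact hs z (by simp) h2
  · exact hs x (by simp) h4

theorem IsUSO.row_trans (h : G.IsUSO) {i x y z} (h1 : G.row i x y) (h2 : G.row i y z) :
    G.row i x z := h.swap.col_trans h1 h2

/-- The number of vertices of the subgrid `A × B` with `k` outgoing edges that change the first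
coordinate and `s` outgoing edges that change the second one, both inside the subgrid. -/
noncomputable def indexCount (G : GridOrientation α β) (A : Finset α) (B : Finset β) (k s : ℕ) : ℕ :=
  #{p ∈ A ×ˢ B | #{x ∈ A | G.col p.2 p.1 x} = k ∧ #{y ∈ B | G.row p.1 p.2 y} = s}

theorem indexCount_swap (A : Finset α) (B : Finset β) (k s : ℕ) :
    G.swap.indexCount B A s k = G.indexCount A B k s := by
  unfold indexCount
  refine Finset.card_bij' (fun p _ => p.swap) (fun p _ => p.swap) ?_ ?_ ?_ ?_
  · intro p hp
    rw [Finset.mem_filter, Finset.mem_product] at hp ⊢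
    exact ⟨hp.1.symm, hp.2.symm⟩
  · intro p hp
    rw [Finset.mem_filter, Finset.mem_product] at hp ⊢
    exact ⟨hp.1.symm, hp.2.symm⟩
  · intro p _; rfl
  · intro p _; rfl

theorem IsUSO.indexCount_zero (h : G.IsUSO) {A : Finset α} {B : Finset β} (hA : A.Nonempty)
    (hB : B.Nonempty) : G.indexCount A B 0 0 = 1 := by
  obtain ⟨p, ⟨hp1, hp2⟩, hp⟩ := h.exists_unique_sink A B hA hB
  rw [indexCount, Finset.card_eq_one]
  refine ⟨p, ?_⟩
  ext q
  simp only [Finset.mem_filter, Finset.mem_product, Finset.card_eq_zero, Finset.mem_singleton,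
    Finset.filter_eq_empty_iff]
  constructor
  · rintro ⟨h1, h2, h3⟩
    exact hp q ⟨h1, h2, h3⟩
  · rintro rfl
    exact ⟨hp1, hp2⟩

/-- Deleting `x` lowers the out-degree of `i` by one if `x` is an out-neighbour and leaves it alone
otherwise. So degree `k` remains after deleting one of the `#A - 1 - k` other non-out-neighbours at
degree `k`, or one of the `k + 1` out-neighbours at degree `k + 1`. -/
theorem IsUSO.card_filter_erase_eq (h : G.IsUSO) {A : Finset α} {i : α} (hi : i ∈ A) (j : β)
    (k : ℕ) :
    #{x ∈ A | i ≠ x ∧ #{y ∈ A.erase x | G.col j i y} = k} =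
      (#A - 1 - k) * (if #{x ∈ A | G.col j i x} = k then 1 else 0) +
        (k + 1) * (if #{x ∈ A | G.col j i x} = k + 1 then 1 else 0) := by
  have key : ∀ x ∈ A, #{y ∈ A.erase x | G.col j i y} =
      if G.col j i x then #{y ∈ A | G.col j i y} - 1 else #{y ∈ A | G.col j i y} := by
    intro x hx
    rw [Finset.filter_erase, Finset.card_erase_eq_ite]
    simp [hx]
  have hirr : ∀ x, G.col j i x → i ≠ x := by
    rintro x hx rfl
    exact h.col_irrefl _ _ hx
  by_cases h1 : #{x ∈ A | G.col j i x} = k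
  · have : {x ∈ A | i ≠ x ∧ #{y ∈ A.erase x | G.col j i y} = k} =
        (A.erase i) \ {x ∈ A | G.col j i x} := by
      ext x
      simp only [Finset.mem_filter, Finset.mem_sdiff, Finset.mem_erase, not_and]
      constructor
      · rintro ⟨hx, hix, h2⟩
        refine ⟨⟨Ne.symm hix, hx⟩, fun _ hc => ?_⟩
        rw [key x hx, if_pos hc] at h2
        have : 0 < #{x ∈ A | G.col j i x} := Finset.card_pos.2 ⟨x, by simp [hx, hc]⟩
        omega
      · rintro ⟨⟨hxi, hx⟩, h2⟩
        refine ⟨hx, Ne.symm hxi, ?_⟩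
        rw [key x hx, if_neg (h2 hx), h1]
    rw [this, Finset.card_sdiff_of_subset, Finset.card_erase_of_mem hi]
    · simp [h1]
    · intro x hx
      rw [Finset.mem_filter] at hx
      exact Finset.mem_erase.2 ⟨(hirr x hx.2).symm, hx.1⟩
  by_cases h2 : #{x ∈ A | G.col j i x} = k + 1
  · have : {x ∈ A | i ≠ x ∧ #{y ∈ A.erase x | G.col j i y} = k} =
        {x ∈ A | G.col j i x} := by
      ext x
      simp only [Finset.mem_filter]
      constructor
      · rintro ⟨hx, hix, h3⟩
        refine ⟨hx, ?_⟩
        by_contra hc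
        rw [key x hx, if_neg hc] at h3
        omega
      · rintro ⟨hx, hc⟩
        refine ⟨hx, hirr x hc, ?_⟩
        rw [key x hx, if_pos hc, h2]
        rfl
    rw [this]
    simp [h2]
  · rw [if_neg h1, if_neg h2, Nat.mul_zero, Nat.mul_zero, Finset.card_eq_zero,
      Finset.filter_eq_empty_iff]
    rintro x hx ⟨-, h3⟩
    rw [key x hx] at h3
    split_ifs at h3 with hc
    · have : 0 < #{x ∈ A | G.col j i x} := Finset.card_pos.2 ⟨x, by simp [hx, hc]⟩
      omega
    · omega

theorem IsUSO.sum_indexCount_erase (h : G.IsUSO) (A : Finset α) (B : Finset β) (k s : ℕ) :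
    ∑ x ∈ A, G.indexCount (A.erase x) B k s =
      (#A - 1 - k) * G.indexCount A B k s + (k + 1) * G.indexCount A B (k + 1) s := by
  have h1 : ∀ x ∈ A, G.indexCount (A.erase x) B k s = ∑ p ∈ A ×ˢ B,
      if (p.1 ≠ x ∧ #{y ∈ A.erase x | G.col p.2 p.1 y} = k) ∧ #{y ∈ B | G.row p.1 p.2 y} = s
      then 1 else 0 := by
    intro x _
    rw [indexCount, ← Finset.card_filter]
    congr 1
    ext p
    simp only [Finset.mem_filter, Finset.mem_product, Finset.mem_erase]
    tauto
  rw [Finset.sum_congr rfl h1, Finset.sum_comm, indexCount, indexCount, Finset.card_filter,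
    Finset.card_filter, Finset.mul_sum, Finset.mul_sum, ← Finset.sum_add_distrib]
  refine Finset.sum_congr rfl fun p hp => ?_
  have := h.card_filter_erase_eq (Finset.mem_product.1 hp).1 p.2 k
  by_cases h3 : #{y ∈ B | G.row p.1 p.2 y} = s
  · simp only [h3, and_true]
    rw [← this, Finset.card_filter]
  · simp [h3]

/-- Induction on the size of the subgrid. With all smaller counts equal to one, the deletion
identity reads `#A = (#A - 1 - k) + (k + 1) * N`, where `N` is the count at `k + 1`, so the value
one passes from `k` to `k + 1`. The unique sink starts the induction at `(0, 0)`. -/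
theorem IsUSO.indexCount_eq_one (h : G.IsUSO) (n : ℕ) : ∀ (A : Finset α) (B : Finset β),
    #A + #B = n → ∀ k s, k < #A → s < #B → G.indexCount A B k s = 1 := by
  induction n using Nat.strong_induction_on with
  | _ n ih =>
    intro A B hn
    have hcol : ∀ k s, k + 1 < #A → s < #B → G.indexCount A B k s = 1 →
        G.indexCount A B (k + 1) s = 1 := by
      intro k s hk hs h1
      have h2 := h.sum_indexCount_erase A B k s
      rw [Finset.sum_congr rfl (g := fun _ => 1), h1, Finset.sum_const, smul_eq_mul] at h2
      · have h3 : (k + 1) * G.indexCount A B (k + 1) s = (k + 1) * 1 := by omega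
        exact Nat.eq_of_mul_eq_mul_left (by omega) h3
      · intro x hx
        have hc := Finset.card_erase_of_mem hx
        exact ih (#(A.erase x) + #B) (by omega) _ _ rfl k s (by omega) hs
    have hrow : ∀ k s, k < #A → s + 1 < #B → G.indexCount A B k s = 1 →
        G.indexCount A B k (s + 1) = 1 := by
      intro k s hk hs h1
      have h2 := h.swap.sum_indexCount_erase B A s k
      simp only [indexCount_swap] at h2
      rw [Finset.sum_congr rfl (g := fun _ => 1), h1, Finset.sum_const, smul_eq_mul] at h2
      · have h3 : (s + 1) * G.indexCount A B k (s + 1) = (s + 1) * 1 := by omega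
        exact Nat.eq_of_mul_eq_mul_left (by omega) h3
      · intro x hx
        have hc := Finset.card_erase_of_mem hx
        exact ih (#A + #(B.erase x)) (by omega) _ _ rfl k s hk (by omega)
    intro k
    induction k with
    | zero =>
      intro s
      induction s with
      | zero =>
        intro hA hB
        exact h.indexCount_zero (Finset.card_pos.1 hA) (Finset.card_pos.1 hB)
      | succ s ihs => exact fun hA hB => hrow 0 s hA hB (ihs hA (by omega))
    | succ k ihk => exact fun s hA hB => hcol k s hA hB (ihk s (by omega) hB)

/-- In a unique sink orientation, exactly `k * s` vertices of a subgrid have fewer than `k`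
outgoing edges in the first direction and fewer than `s` in the second one. -/
theorem IsUSO.card_index_lt (h : G.IsUSO) (A : Finset α) (B : Finset β) (k s : ℕ) (hk : k ≤ #A)
    (hs : s ≤ #B) :
    #{p ∈ A ×ˢ B | #{x ∈ A | G.col p.2 p.1 x} < k ∧ #{y ∈ B | G.row p.1 p.2 y} < s} = k * s := by
  have := Finset.card_eq_sum_card_fiberwise
    (s := {p ∈ A ×ˢ B | #{x ∈ A | G.col p.2 p.1 x} < k ∧ #{y ∈ B | G.row p.1 p.2 y} < s})
    (t := Finset.range k ×ˢ Finset.range s)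
    (f := fun p => (#{x ∈ A | G.col p.2 p.1 x}, #{y ∈ B | G.row p.1 p.2 y}))
    (by intro p hp; simpa using (Finset.mem_filter.1 hp).2)
  rw [this, Finset.sum_congr rfl (g := fun _ => 1)]
  · simp
  · rintro ⟨k', s'⟩ hks
    simp only [Finset.mem_product, Finset.mem_range] at hks
    rw [← h.indexCount_eq_one _ A B rfl k' s' (by omega) (by omega), indexCount]
    congr 1
    ext p
    simp only [Finset.mem_filter, Prod.mk.injEq]
    constructor
    · rintro ⟨⟨h1, _⟩, h2⟩; exact ⟨h1, h2⟩
    · rintro ⟨h1, h2, h3⟩; exact ⟨⟨h1, by omega, by omega⟩, h2, h3⟩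

/-- The out-neighbours of `(i, j)` that share the second coordinate. -/
noncomputable def outL [Fintype α] (G : GridOrientation α β) (i : α) (j : β) : Finset α := {x | G.col j i x}

/-- The out-neighbours of `(i, j)` that share the first coordinate. -/
noncomputable def outR [Fintype β] (G : GridOrientation α β) (i : α) (j : β) : Finset β := {y | G.row i j y}

@[simp] theorem mem_outL [Fintype α] {i x : α} {j : β} : x ∈ G.outL i j ↔ G.col j i x := by simp [outL]

@[simp] theorem mem_outR [Fintype β] {i : α} {j y : β} : y ∈ G.outR i j ↔ G.row i j y := by simp [outR]

@[simp] theorem swap_outL [Fintype β] (i : α) (j : β) : G.swap.outL j i = G.outR i j := rfl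

@[simp] theorem swap_outR [Fintype α] (i : α) (j : β) : G.swap.outR j i = G.outL i j := rfl

theorem IsUSO.outR_subset [Fintype β] (h : G.IsUSO) {i : α} {j j' : β} (hj : G.row i j j') :
    G.outR i j' ⊆ G.outR i j := fun y hy => by
  rw [mem_outR] at hy ⊢
  exact h.row_trans hj hy

theorem IsUSO.card_outR_lt [Fintype β] (h : G.IsUSO) {i : α} {j j' : β} (hj : G.row i j j') :
    #(G.outR i j') < #(G.outR i j) := by
  refine Finset.card_lt_card ⟨h.outR_subset hj, fun hs => ?_⟩
  exact h.row_irrefl i j' (mem_outR.1 (hs (mem_outR.2 hj)))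

theorem IsUSO.card_outR_lt_iff [Fintype β] (h : G.IsUSO) {i : α} {j j' : β} :
    #(G.outR i j') < #(G.outR i j) ↔ G.row i j j' := by
  refine ⟨fun hlt => ?_, h.card_outR_lt⟩
  by_contra hn
  have hne : j ≠ j' := by rintro rfl; exact lt_irrefl _ hlt
  exact absurd (h.card_outR_lt (h.row_total hne hn)) (by omega)

theorem IsUSO.card_outR_injective [Fintype β] (h : G.IsUSO) (i : α) :
    Function.Injective fun j => #(G.outR i j) := by
  intro j j' he
  by_contra hne
  by_cases hr : G.row i j j'
  · exact absurd (h.card_outR_lt hr) (by simp only at he; omega)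
  · exact absurd (h.card_outR_lt (h.row_total hne hr)) (by simp only at he; omega)

theorem IsUSO.card_filter_outR_lt [Fintype β] (h : G.IsUSO) (i : α) (m : ℕ) (hm : m ≤ Fintype.card β) :
    #{y | #(G.outR i y) < m} = m := by
  have := h.card_index_lt {i} Finset.univ 1 m (by simp) (by simpa using hm)
  rw [one_mul] at this
  refine Eq.trans ?_ this
  refine Finset.card_bij' (fun y _ => (i, y)) (fun p _ => p.2) ?_ ?_ ?_ ?_
  · intro y hy
    simp only [Finset.mem_filter, Finset.mem_univ, true_and] at hy
    simp only [Finset.mem_filter, Finset.mem_product, Finset.mem_singleton, Finset.mem_univ,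
      and_true, true_and]
    refine ⟨?_, hy⟩
    rw [Finset.card_filter, Finset.sum_singleton, if_neg (h.col_irrefl _ _)]
    exact one_pos
  · rintro ⟨x, y⟩ hy
    simp only [Finset.mem_filter, Finset.mem_product, Finset.mem_singleton, Finset.mem_univ,
      and_true] at hy
    obtain ⟨rfl, -, h2⟩ := hy
    exact Finset.mem_filter.2 ⟨Finset.mem_univ _, h2⟩
  · intro y _; rfl
  · rintro ⟨x, y⟩ hy
    simp only [Finset.mem_filter, Finset.mem_product, Finset.mem_singleton, Finset.mem_univ,
      and_true] at hy
    simp [hy.1]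

theorem IsUSO.card_filter_outR_lt_le [Fintype β] (h : G.IsUSO) (i : α) (m : ℕ) :
    #{y | #(G.outR i y) < m} ≤ m := by
  rw [← Finset.card_range m]
  exact Finset.card_le_card_of_injOn (fun y => #(G.outR i y)) (fun y hy => by simpa using hy)
    (h.card_outR_injective i).injOn

theorem IsUSO.outL_subset [Fintype α] (h : G.IsUSO) {i x : α} {j : β} (hx : G.col j i x) :
    G.outL x j ⊆ G.outL i j := h.swap.outR_subset hx

end GridOrientation

/-! ### Closed walks along a relation. -/

section ClosedWalk

variable {V : Type*} {r : V → V → Prop}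

/-- There is a closed walk with `n` steps along `r`. -/
def HasClosedWalk (r : V → V → Prop) (n : ℕ) : Prop :=
  ∃ c : ℕ → V, (∀ t < n, r (c t) (c (t + 1))) ∧ c n = c 0

theorem HasClosedWalk.of_eq {c : ℕ → V} (hc : ∀ t, r (c t) (c (t + 1))) {s t : ℕ} (hst : s ≤ t)
    (h : c t = c s) : HasClosedWalk r (t - s) :=
  ⟨fun u => c (s + u), fun _ _ => hc _, by simp [Nat.add_sub_cancel' hst, h]⟩

theorem HasClosedWalk.of_edge {c : ℕ → V} (hc : ∀ t, r (c t) (c (t + 1))) {s t : ℕ} (hst : s ≤ t)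
    (h : r (c t) (c s)) : HasClosedWalk r (t - s + 1) := by
  refine ⟨fun u => if u ≤ t - s then c (s + u) else c s, fun u hu => ?_, by simp⟩
  rcases Nat.lt_succ_iff_lt_or_eq.1 hu with h1 | h1
  · simpa [h1.le, Nat.succ_le_of_lt h1, ← add_assoc] using hc (s + u)
  · subst h1
    simpa [Nat.add_sub_cancel' hst] using h

theorem HasClosedWalk.of_path {c : ℕ → V} (hc : ∀ t, r (c t) (c (t + 1))) {s t : ℕ} (hst : s ≤ t)
    {x : V} (h1 : r (c t) x) (h2 : r x (c s)) : HasClosedWalk r (t - s + 2) := by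
  refine ⟨fun u => if u ≤ t - s then c (s + u) else if u = t - s + 1 then x else c s,
    fun u hu => ?_, by simp⟩
  rcases lt_trichotomy u (t - s) with h3 | h3 | h3
  · simpa [h3.le, Nat.succ_le_of_lt h3, ← add_assoc] using hc (s + u)
  · subst h3
    simpa [Nat.add_sub_cancel' hst] using h1
  · obtain rfl : u = t - s + 1 := by omega
    simpa using h2

theorem HasClosedWalk.exists_periodic {n : ℕ} (hn : 0 < n) (h : HasClosedWalk r n) :
    ∃ c : ℕ → V, (∀ t, r (c t) (c (t + 1))) ∧ ∀ t, c (t + n) = c t := by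
  obtain ⟨c, hc, h0⟩ := h
  refine ⟨fun t => c (t % n), fun t => ?_, fun t => by simp⟩
  have hlt := Nat.mod_lt t hn
  have h1 := hc _ hlt
  rcases Nat.lt_or_eq_of_le (Nat.succ_le_of_lt hlt) with h2 | h2
  · have : (t + 1) % n = t % n + 1 := by
      rw [Nat.add_mod, Nat.mod_eq_of_lt (a := t % n + 1 % n)]
      · rw [Nat.mod_eq_of_lt (a := 1) (by omega)]
      · rw [Nat.mod_eq_of_lt (a := 1) (by omega)]; exact h2
    simpa only [this] using h1
  · have : (t + 1) % n = 0 := by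
      rw [← Nat.mod_add_mod, ← Nat.succ_eq_add_one, h2, Nat.mod_self]
    simp only [this]
    rwa [← Nat.succ_eq_add_one, h2, h0] at h1

theorem exists_walk_of_reflTransGen {u v : V} (h : Relation.ReflTransGen r u v) :
    ∃ (n : ℕ) (c : ℕ → V), c 0 = u ∧ c n = v ∧ ∀ t < n, r (c t) (c (t + 1)) := by
  induction h using Relation.ReflTransGen.head_induction_on with
  | refl => exact ⟨0, fun _ => v, rfl, rfl, by simp⟩
  | @head a b h1 _ ih =>
    obtain ⟨n, c, h2, h3, h4⟩ := ih
    refine ⟨n + 1, fun t => Nat.casesOn t a c, rfl, h3, fun t ht => ?_⟩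
    cases t with
    | zero => simpa [h2] using h1
    | succ t => exact h4 t (by omega)

theorem exists_hasClosedWalk_of_transGen {v : V} (h : Relation.TransGen r v v) :
    ∃ n, 0 < n ∧ HasClosedWalk r n := by
  obtain ⟨w, h1, h2⟩ := Relation.TransGen.head'_iff.1 h
  obtain ⟨n, c, h3, h4, h5⟩ := exists_walk_of_reflTransGen h2
  refine ⟨n + 1, n.succ_pos, fun t => Nat.casesOn t v c, fun t ht => ?_, h4⟩
  cases t with
  | zero => simpa [h3] using h1
  | succ t => exact h5 t (by omega)

end ClosedWalk

/-! ### Acyclicity of unique sink orientations of grids. -/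

namespace GridOrientation

open Classical Finset

variable {α β : Type*} {G : GridOrientation α β}

/-- The directed edges of the grid. -/
def Step (G : GridOrientation α β) (u v : α × β) : Prop :=
  (u.2 = v.2 ∧ G.col u.2 u.1 v.1) ∨ (u.1 = v.1 ∧ G.row u.1 u.2 v.2)

theorem Step.of_col {i i' : α} {j : β} (h : G.col j i i') : G.Step (i, j) (i', j) :=
  Or.inl ⟨rfl, h⟩

theorem Step.of_row {i : α} {j j' : β} (h : G.row i j j') : G.Step (i, j) (i, j') :=
  Or.inr ⟨rfl, h⟩

theorem Step.swap {u v : α × β} (h : G.Step u v) : G.swap.Step u.swap v.swap :=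
  Or.symm h

theorem IsUSO.not_step_self (h : G.IsUSO) (u : α × β) : ¬ G.Step u u := by
  rintro (⟨-, h1⟩ | ⟨-, h1⟩)
  · exact h.col_irrefl _ _ h1
  · exact h.row_irrefl _ _ h1

theorem IsUSO.step_asymm (h : G.IsUSO) {u v : α × β} (h1 : G.Step u v) : ¬ G.Step v u := by
  obtain ⟨i, j⟩ := u
  obtain ⟨i', j'⟩ := v
  rcases h1 with ⟨h1, h2⟩ | ⟨h1, h2⟩ <;> rintro (⟨h3, h4⟩ | ⟨h3, h4⟩) <;>
    simp only at h1 h2 h3 h4 <;> subst h1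
  · exact h.col_asymm h2 h4
  · subst h3; exact h.col_irrefl _ _ h2
  · subst h3; exact h.row_irrefl _ _ h2
  · exact h.row_asymm h2 h4

theorem IsUSO.step_or_step_of_row (h : G.IsUSO) {i : α} {j j' : β} (hne : j ≠ j') :
    G.Step (i, j) (i, j') ∨ G.Step (i, j') (i, j) := by
  by_cases h1 : G.row i j j'
  · exact Or.inl (.of_row h1)
  · exact Or.inr (.of_row (h.row_total hne h1))

theorem IsUSO.step_or_step_of_col (h : G.IsUSO) {i i' : α} {j : β} (hne : i ≠ i') :
    G.Step (i, j) (i', j) ∨ G.Step (i', j) (i, j) := by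
  by_cases h1 : G.col j i i'
  · exact Or.inl (.of_col h1)
  · exact Or.inr (.of_col (h.col_total hne h1))

theorem IsUSO.not_two_sinks (h : G.IsUSO) {i i' : α} {j j' : β} (h1 : G.row i j j')
    (h2 : G.col j' i' i) (h3 : G.row i' j' j) (h4 : G.col j i i') : False := by
  have hs : G.IsSinkIn {i, i'} {j, j'} i j' :=
    ⟨by simpa using ⟨h.col_irrefl _ _, h.col_asymm h2⟩,
      by simpa using ⟨h.row_asymm h1, h.row_irrefl _ _⟩⟩
  have hs' : G.IsSinkIn {i, i'} {j, j'} i' j :=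
    ⟨by simpa using ⟨h.col_asymm h4, h.col_irrefl _ _⟩,
      by simpa using ⟨h.row_irrefl _ _, h.row_asymm h3⟩⟩
  obtain ⟨rfl, -⟩ := h.sink_eq (by simp) (by simp) (by simp) (by simp) hs hs'
  exact h.col_irrefl _ _ h2

theorem IsUSO.not_four_cycle (h : G.IsUSO) {i i' : α} {j j' : β} (h1 : G.row i j j')
    (h2 : G.col j' i i') (h3 : G.row i' j' j) (h4 : G.col j i' i) : False := by
  obtain ⟨⟨x, y⟩, ⟨⟨hx, hy⟩, hs, hs'⟩, -⟩ :=
    h.exists_unique_sink {i, i'} {j, j'} (by simp) (by simp)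
  simp only [Finset.mem_insert, Finset.mem_singleton] at hx hy hs hs'
  rcases hx with rfl | rfl <;> rcases hy with rfl | rfl
  · exact hs' _ (Or.inr rfl) h1
  · exact hs _ (Or.inr rfl) h2
  · exact hs _ (Or.inl rfl) h4
  · exact hs' _ (Or.inl rfl) h3

/-- A closed walk that alternates between the two directions, given by its coordinates. -/
structure AlternatingCycle (G : GridOrientation α β) (p : ℕ → α) (q : ℕ → β) (k : ℕ) : Prop where
  row : ∀ s, G.row (p s) (q s) (q (s + 1))
  col : ∀ s, G.col (q (s + 1)) (p s) (p (s + 1))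
  period_fst : ∀ s, p (s + k) = p s
  period_snd : ∀ s, q (s + k) = q s

/-- The vertices of an alternating cycle in their order. -/
def cycleVertex (p : ℕ → α) (q : ℕ → β) (t : ℕ) : α × β := (p (t / 2), q ((t + 1) / 2))

theorem cycleVertex_even (p : ℕ → α) (q : ℕ → β) (s : ℕ) : cycleVertex p q (2 * s) = (p s, q s) := by
  have h1 : 2 * s / 2 = s := by omega
  have h2 : (2 * s + 1) / 2 = s := by omega
  rw [cycleVertex, h1, h2]

theorem cycleVertex_odd (p : ℕ → α) (q : ℕ → β) (s : ℕ) :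
    cycleVertex p q (2 * s + 1) = (p s, q (s + 1)) := by
  have h1 : (2 * s + 1) / 2 = s := by omega
  have h2 : (2 * s + 1 + 1) / 2 = s + 1 := by omega
  rw [cycleVertex, h1, h2]

theorem AlternatingCycle.step {p : ℕ → α} {q : ℕ → β} {k : ℕ} (hc : G.AlternatingCycle p q k)
    (t : ℕ) : G.Step (cycleVertex p q t) (cycleVertex p q (t + 1)) := by
  obtain ⟨s, rfl | rfl⟩ : ∃ s, t = 2 * s ∨ t = 2 * s + 1 := ⟨t / 2, by omega⟩
  · rw [cycleVertex_even, cycleVertex_odd]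
    exact .of_row (hc.row s)
  · rw [cycleVertex_odd, show 2 * s + 1 + 1 = 2 * (s + 1) by ring, cycleVertex_even]
    exact .of_col (hc.col s)

/-- Minimality forces every grid point `(p s, q (s + e + 1))` off the cycle to be either a sink or a
source with respect to the four cycle vertices on its two lines. Uniqueness of sinks in 2 × 2
subgrids makes certain pairs of these points have opposite types, and these constraints are
inconsistent. -/
theorem AlternatingCycle.false_of_minimal (h : G.IsUSO) {p : ℕ → α} {q : ℕ → β} {k : ℕ}
    (hc : G.AlternatingCycle p q k) (hk : 2 ≤ k)
    (hmin : ∀ n, 0 < n → n < 2 * k → ¬ HasClosedWalk G.Step n) : False := by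
  have ev := cycleVertex_even p q
  have od := cycleVertex_odd p q
  have edge : ∀ {s t}, s ≤ t → t - s + 1 < 2 * k →
      ¬ G.Step (cycleVertex p q t) (cycleVertex p q s) := fun hst hlt he =>
    hmin _ (by omega) hlt (.of_edge hc.step hst he)
  have path : ∀ {s t}, s ≤ t → t - s + 2 < 2 * k → ∀ x,
      ¬ (G.Step (cycleVertex p q t) x ∧ G.Step x (cycleVertex p q s)) := fun hst hlt x he =>
    hmin _ (by omega) hlt (.of_path hc.step hst he.1 he.2)
  have hper : ∀ s, cycleVertex p q (2 * s + 2 * k) = cycleVertex p q (2 * s) := fun s => by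
    rw [← mul_add, ev, ev, hc.period_fst, hc.period_snd]
  have hev : ∀ {s m}, s < m → m < s + k → (p s, q s) ≠ (p m, q m) := fun {s m} h1 h2 he => by
    rw [← ev, ← ev] at he
    exact hmin _ (by omega) (by omega) (.of_eq hc.step (s := 2 * s) (t := 2 * m) (by omega) he.symm)
  have hadj : ∀ {s m}, s < m → m < s + k →
      ¬ (G.Step (p s, q s) (p m, q m) ∨ G.Step (p m, q m) (p s, q s)) := by
    rintro s m h1 h2 (he | he)
    · rw [← ev, ← ev, ← hper] at he
      exact edge (by omega) (by omega) he
    · rw [← ev, ← ev] at he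
      exact edge (by omega) (by omega) he
  have hp : ∀ {s m}, s < m → m < s + k → p s ≠ p m := fun {s m} h1 h2 he => by
    have h3 : q s ≠ q m := fun h4 => hev h1 h2 (by rw [he, h4])
    have h4 := hadj h1 h2
    rw [he] at h4
    exact h4 (h.step_or_step_of_row h3)
  have hq : ∀ {s m}, s < m → m < s + k → q s ≠ q m := fun {s m} h1 h2 he => by
    have h3 : p s ≠ p m := fun h4 => hev h1 h2 (by rw [he, h4])
    have h4 := hadj h1 h2
    rw [he] at h4
    exact h4 (h.step_or_step_of_col h3)
  -- A detour through an off-cycle point that skips part of the cycle would give a shorter closed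
  -- walk; `no1` shortcuts between vertices of even position, `no2` closes up vertices of odd
  -- position.
  have no1 : ∀ {s e}, 2 ≤ e → e < k →
      ¬ (G.row (p s) (q s) (q (s + e)) ∧ G.col (q (s + e)) (p s) (p (s + e))) := by
    rintro s e h1 h2 ⟨h3, h4⟩
    refine path (s := 2 * (s + e)) (t := 2 * s + 2 * k) (by omega) (by omega) (p s, q (s + e)) ?_
    rw [hper, ev, ev]
    exact ⟨.of_row h3, .of_col h4⟩
  have no2 : ∀ {s e}, 1 ≤ e → e + 1 < k →
      ¬ (G.col (q (s + e + 1)) (p (s + e)) (p s) ∧ G.row (p s) (q (s + e + 1)) (q (s + 1))) := by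
    rintro s e h1 h2 ⟨h3, h4⟩
    refine path (s := 2 * s + 1) (t := 2 * (s + e) + 1) (by omega) (by omega)
      (p s, q (s + e + 1)) ?_
    rw [od, od]
    exact ⟨.of_col h3, .of_row h4⟩
  have sink : ∀ {s e}, 1 ≤ e → e + 1 < k → G.row (p s) (q (s + 1)) (q (s + e + 1)) →
      G.row (p s) (q s) (q (s + e + 1)) ∧ G.col (q (s + e + 1)) (p (s + e + 1)) (p s) ∧
        G.col (q (s + e + 1)) (p (s + e)) (p s) := by
    intro s e h1 h2 h3
    have h4 := h.row_trans (hc.row s) h3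
    have h5 := h.col_total (hp (s := s) (m := s + e + 1) (by omega) (by omega))
      fun h5 => no1 (s := s) (e := e + 1) (by omega) h2 ⟨h4, h5⟩
    exact ⟨h4, h5, h.col_trans (hc.col _) h5⟩
  have source : ∀ {s e}, 1 ≤ e → e + 1 < k → ¬ G.row (p s) (q (s + 1)) (q (s + e + 1)) →
      G.row (p s) (q (s + e + 1)) (q (s + 1)) ∧ G.row (p s) (q (s + e + 1)) (q s) ∧
        G.col (q (s + e + 1)) (p s) (p (s + e + 1)) ∧ G.col (q (s + e + 1)) (p s) (p (s + e)) := by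
    intro s e h1 h2 h3
    have h4 := h.row_total (hq (s := s + 1) (m := s + e + 1) (by omega) (by omega)) h3
    have h5 := h.col_total (hp (s := s) (m := s + e) (by omega) (by omega)).symm
      fun h5 => no2 h1 h2 ⟨h5, h4⟩
    have h6 := h.col_trans h5 (hc.col _)
    have h7 := h.row_total (hq (s := s) (m := s + e + 1) (by omega) (by omega))
      fun h7 => no1 (s := s) (e := e + 1) (by omega) h2 ⟨h7, h6⟩
    exact ⟨h4, h7, h6, h5⟩
  -- The two points compared are opposite corners of a 2 × 2 subgrid whose other corners lie on the
  -- cycle. Two sinks are excluded directly; two sources would make the cycle corners two sinks.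
  have star : ∀ {s e e'}, 1 ≤ e → 1 ≤ e' → e + e' + 1 = k →
      (G.row (p s) (q (s + 1)) (q (s + e + 1)) ↔
        ¬ G.row (p (s + e)) (q (s + e + 1)) (q (s + e + e' + 1))) := by
    intro s e e' h1 h2 h3
    have hs : s + e + e' + 1 = s + k := by omega
    constructor
    · intro h4 h5
      obtain ⟨h6, -, h7⟩ := sink h1 (by omega) h4
      obtain ⟨-, h8, -⟩ := sink h2 (by omega) h5
      rw [hs, hc.period_snd] at h5 h8
      rw [hc.period_fst] at h8
      exact h.not_two_sinks h6 h7 h5 h8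
    · intro h5
      by_contra h4
      obtain ⟨-, h6, -, h7⟩ := source h1 (by omega) h4
      obtain ⟨h8, -, h9, -⟩ := source h2 (by omega) h5
      rw [hs, hc.period_snd] at h8 h9
      rw [hc.period_fst] at h9
      exact h.not_two_sinks h6 h9 h8 h7
  have star' : ∀ {s e e'}, 1 ≤ e → 1 ≤ e' → e + e' + 2 = k →
      (G.row (p s) (q (s + 1)) (q (s + e + 1)) ↔
        ¬ G.row (p (s + e + 1)) (q (s + e + 1 + 1)) (q (s + e + 1 + e' + 1))) := by
    intro s e e' h1 h2 h3
    have hs : s + e + 1 + e' + 1 = s + k := by omega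
    constructor
    · intro h4 h5
      obtain ⟨h6, h7, -⟩ := sink h1 (by omega) h4
      obtain ⟨h5, h8, -⟩ := sink h2 (by omega) h5
      rw [hs, hc.period_snd] at h5 h8
      rw [hc.period_fst] at h8
      exact h.not_two_sinks h6 h7 h5 h8
    · intro h5
      by_contra h4
      obtain ⟨-, h6, h7, -⟩ := source h1 (by omega) h4
      obtain ⟨-, h8, h9, -⟩ := source h2 (by omega) h5
      rw [hs, hc.period_snd] at h8 h9
      rw [hc.period_fst] at h9
      exact h.not_two_sinks h6 h9 h8 h7
  rcases Nat.lt_or_ge k 3 with hk3 | hk3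
  · obtain rfl : k = 2 := by omega
    have h1 := hc.row 1
    have h2 := hc.col 1
    rw [show 1 + 1 = 0 + 2 from rfl, hc.period_snd] at h1 h2
    rw [hc.period_fst] at h2
    exact h.not_four_cycle (hc.row 0) (hc.col 0) h1 h2
  -- The points at `e` and `e + 1` on the line `p 1` are both opposite in type to one common point,
  -- by `star'` and `star`.
  have const : ∀ e, 1 ≤ e → e + 1 < k →
      (G.row (p 1) (q (1 + 1)) (q (1 + 1 + 1)) ↔ G.row (p 1) (q (1 + 1)) (q (1 + e + 1))) := by
    intro e he
    induction e, he using Nat.le_induction with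
    | base => exact fun _ => Iff.rfl
    | succ e he ih =>
      intro h1
      rw [ih (by omega), star' (e' := k - e - 2) he (by omega) (by omega),
        star (e := e + 1) (e' := k - e - 2) (by omega) (by omega) (by omega)]
      rfl
  -- Together with constancy along the line `p 1`, three applications of `star` form an odd chain of
  -- negations from the type of `(p 0, q 2)` back to itself.
  have c1 := star (s := 0) (e := 1) (e' := k - 2) le_rfl (by omega) (by omega)
  have c2 := star (s := 1) (e := 1) (e' := k - 2) le_rfl (by omega) (by omega)
  have c3 := star (s := 2) (e := k - 2) (e' := 1) (by omega) le_rfl (by omega)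
  have c4 := const (k - 2) (by omega) (by omega)
  have e1 : 2 + (k - 2) = 0 + k := by omega
  rw [e1, hc.period_fst, show 0 + k + 1 + 1 = 0 + 1 + 1 + k by omega,
    show 0 + k + 1 = 0 + 1 + k by omega, hc.period_snd, hc.period_snd] at c3
  have e3 : 1 + 1 + (k - 2) + 1 = 0 + 1 + k := by omega
  rw [e3, hc.period_snd] at c2
  norm_num at c1 c2 c3 c4
  tauto

/-- The minimal closed walks alternate between the two directions, which is impossible. -/
theorem IsUSO.not_hasClosedWalk (h : G.IsUSO) {n : ℕ} (hn : 0 < n) : ¬ HasClosedWalk G.Step n := by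
  induction n using Nat.strong_induction_on with
  | _ n ih =>
  intro hw
  have hmin : ∀ m, 0 < m → m < n → ¬ HasClosedWalk G.Step m := fun m h1 h2 => ih m h2 h1
  obtain ⟨c, hc, hper⟩ := hw.exists_periodic hn
  have hn3 : 3 ≤ n := by
    by_contra hlt
    obtain rfl | rfl : n = 1 ∨ n = 2 := by omega
    · have := hc 0
      rw [hper 0] at this
      exact h.not_step_self _ this
    · have h1 := hc 1
      rw [show 1 + 1 = 0 + 2 from rfl, hper 0] at h1
      exact h.step_asymm (hc 0) h1
  -- A shortcut over two steps would shorten the walk by one. By transitivity within a line,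
  -- consecutive steps therefore change different coordinates.
  have hno : ∀ t, ¬ G.Step (c t) (c (t + 2)) := fun t he => by
    rw [← hper t] at he
    exact hmin _ (by omega) (by omega)
      (HasClosedWalk.of_edge hc (s := t + 2) (t := t + n) (by omega) he)
  have hcol : ∀ t, (c t).1 = (c (t + 1)).1 → (c (t + 1)).2 = (c (t + 2)).2 := fun t ht => by
    rcases hc (t + 1) with h1 | h1
    · exact h1.1
    · exfalso
      rcases hc t with h2 | h2
      · exact h.col_irrefl _ _ (ht ▸ h2.2)
      · refine hno t (Or.inr ⟨ht.trans h1.1, h.row_trans h2.2 ?_⟩)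
        rw [ht]; exact h1.2
  have hrow : ∀ t, (c t).2 = (c (t + 1)).2 → (c (t + 1)).1 = (c (t + 2)).1 := fun t ht => by
    rcases hc (t + 1) with h1 | h1
    · exfalso
      rcases hc t with h2 | h2
      · refine hno t (Or.inl ⟨ht.trans h1.1, h.col_trans h2.2 ?_⟩)
        rw [ht]; exact h1.2
      · exact h.row_irrefl _ _ (ht ▸ h2.2)
    · exact h1.1
  -- Shifting by one step if necessary, the walk starts with a change of the second coordinate. An
  -- odd period would then violate alternation at the closing point.
  obtain ⟨c, hc, hper, hcol, hrow, h0⟩ : ∃ c : ℕ → α × β, (∀ t, G.Step (c t) (c (t + 1))) ∧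
      (∀ t, c (t + n) = c t) ∧ (∀ t, (c t).1 = (c (t + 1)).1 → (c (t + 1)).2 = (c (t + 2)).2) ∧
      (∀ t, (c t).2 = (c (t + 1)).2 → (c (t + 1)).1 = (c (t + 2)).1) ∧ (c 0).1 = (c 1).1 := by
    rcases hc 0 with h1 | h1
    · refine ⟨fun t => c (t + 1), fun t => hc _, fun t => ?_, fun t => hcol _, fun t => hrow _,
        hrow 0 h1.1⟩
      change c (t + n + 1) = c (t + 1)
      rw [← hper (t + 1)]
      congr 1
      omega
    · exact ⟨c, hc, hper, hcol, hrow, h1.1⟩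
  have heven : ∀ s, (c (2 * s)).1 = (c (2 * s + 1)).1 := by
    intro s
    induction s with
    | zero => exact h0
    | succ s ihs => exact hrow _ (hcol _ ihs)
  have hodd : ∀ s, (c (2 * s + 1)).2 = (c (2 * s + 2)).2 := fun s => hcol _ (heven s)
  have hnot : ∀ t, (c t).1 = (c (t + 1)).1 → (c t).2 ≠ (c (t + 1)).2 := fun t h1 h2 =>
    h.not_step_self (c t) (by
      have := hc t
      rwa [← Prod.ext h1 h2] at this)
  obtain ⟨k, rfl | rfl⟩ : ∃ k, n = 2 * k ∨ n = 2 * k + 1 := ⟨n / 2, by omega⟩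
  swap
  · have h1 := hodd k
    have h2 : c (2 * k + 2) = c 1 := by rw [← hper 1]; congr 1; omega
    have h3 : c (2 * k + 1) = c 0 := by rw [← hper 0]; congr 1; omega
    rw [h2, h3] at h1
    exact hnot 0 h0 h1
  have hcyc : G.AlternatingCycle (fun s => (c (2 * s)).1) (fun s => (c (2 * s)).2) k := by
    refine ⟨fun s => ?_, fun s => ?_, fun s => ?_, fun s => ?_⟩
    · rcases hc (2 * s) with h1 | h1
      · exact absurd h1.1 (hnot _ (heven s))
      · have h2 := h1.2
        rw [hodd s] at h2
        exact h2
    · rcases hc (2 * s + 1) with h1 | h1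
      · have h2 := h1.2
        rw [hodd s, ← heven s] at h2
        exact h2
      · exact absurd (hodd s) (hnot _ h1.1)
    · simp only [mul_add, hper]
    · simp only [mul_add, hper]
  exact hcyc.false_of_minimal h (by omega) hmin

theorem IsUSO.acyclic (h : G.IsUSO) (v : α × β) : ¬ Relation.TransGen G.Step v v := fun hv => by
  obtain ⟨n, hn, hw⟩ := exists_hasClosedWalk_of_transGen hv
  exact h.not_hasClosedWalk hn hw

/-! ### Confinement of directed walks. -/

variable [Fintype α] [Fintype β]

theorem IsUSO.wellFounded (h : G.IsUSO) : WellFounded fun u v => G.Step v u := by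
  have h1 : WellFounded fun u v => Relation.TransGen G.Step v u := by
    have : IsTrans (α × β) fun u v => Relation.TransGen G.Step v u := ⟨fun _ _ _ h1 h2 => h2.trans h1⟩
    have : Std.Irrefl fun u v : α × β => Relation.TransGen G.Step v u := ⟨fun v => h.acyclic v⟩
    exact Finite.wellFounded_of_trans_of_irrefl _
  exact Subrelation.wf (fun h2 => Relation.TransGen.single h2) h1

/-- `(i₀, j₀)` is the sink of the subgrid that omits the lines of its out-neighbours. Any other
vertex of this subgrid has an outgoing edge inside it, and by acyclicity following such edges must
end at the sink. -/
theorem IsUSO.reflTransGen_of_notMem (h : G.IsUSO) {i₀ : α} {j₀ : β} (u : α × β)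
    (h1 : u.1 ∉ G.outL i₀ j₀) (h2 : u.2 ∉ G.outR i₀ j₀) :
    Relation.ReflTransGen G.Step u (i₀, j₀) := by
  induction u using h.wellFounded.induction with
  | _ u ih =>
  by_cases hs : G.IsSinkIn (G.outL i₀ j₀)ᶜ (G.outR i₀ j₀)ᶜ u.1 u.2
  · have hs0 : G.IsSinkIn (G.outL i₀ j₀)ᶜ (G.outR i₀ j₀)ᶜ i₀ j₀ :=
      ⟨fun x hx => by simpa using hx, fun y hy => by simpa using hy⟩
    have := h.sink_eq (by simpa using h1) (by simpa using h2)
      (by simpa using h.col_irrefl _ _) (by simpa using h.row_irrefl _ _) hs hs0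
    rw [← this.1, ← this.2]
  · obtain ⟨i, j⟩ := u
    rw [IsSinkIn, not_and_or] at hs
    push Not at hs
    rcases hs with ⟨x, hx, hx'⟩ | ⟨y, hy, hy'⟩
    · exact .head (.of_col hx') (ih (x, j) (.of_col hx') (by simpa using hx) h2)
    · exact .head (.of_row hy') (ih (i, y) (.of_row hy') h1 (by simpa using hy))

/-- A directed path from `(i₀, j₀)` stays inside the union of the rows and columns of the
out-neighbours of `(i₀, j₀)`. -/
theorem IsUSO.mem_or_mem_of_transGen (h : G.IsUSO) {i₀ i : α} {j₀ j : β}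
    (hr : Relation.TransGen G.Step (i₀, j₀) (i, j)) : i ∈ G.outL i₀ j₀ ∨ j ∈ G.outR i₀ j₀ := by
  by_contra hn
  rw [not_or] at hn
  exact h.acyclic _ (hr.trans_left (h.reflTransGen_of_notMem (i, j) hn.1 hn.2))

/-- Every out-neighbour `(x, j)` of `(i, j)` is reachable from `(i₀, j₀)`, so it lies in the
confined region; since `j` is not responsible for that, `x` is. This bounds the out-degree in one
direction at all reachable vertices outside the lines in `outR i₀ j₀`. -/
theorem IsUSO.outL_subset_of_notMem (h : G.IsUSO) {i₀ i : α} {j₀ j : β}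
    (hr : Relation.ReflTransGen G.Step (i₀, j₀) (i, j)) (hj : j ∉ G.outR i₀ j₀) :
    G.outL i j ⊆ G.outL i₀ j₀ := fun _ hx =>
  (h.mem_or_mem_of_transGen (Relation.TransGen.tail' hr (.of_col (mem_outL.1 hx)))).resolve_right hj

end GridOrientation

/-! ### Harmonic numbers. -/

theorem sum_range_harmonic (n : ℕ) :
    ∑ k ∈ Finset.range n, (harmonic k : ℝ) = n * (harmonic n : ℝ) - n := by
  induction n with
  | zero => simp
  | succ n ih =>
    rw [Finset.sum_range_succ, ih, harmonic_succ]
    push_cast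
    have : (n : ℝ) + 1 ≠ 0 := by positivity
    field_simp
    ring

theorem harmonic_cast_nonneg (n : ℕ) : (0 : ℝ) ≤ (harmonic n : ℝ) := by
  rw [harmonic]
  push_cast
  exact Finset.sum_nonneg fun _ _ => by positivity

theorem harmonic_cast_mono {m n : ℕ} (h : m ≤ n) : (harmonic m : ℝ) ≤ (harmonic n : ℝ) := by
  simp only [harmonic]
  push_cast
  exact Finset.sum_le_sum_of_subset_of_nonneg (Finset.range_mono h) fun _ _ _ => by positivity

theorem one_le_harmonic_cast {n : ℕ} (h : 1 ≤ n) : (1 : ℝ) ≤ (harmonic n : ℝ) := by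
  have := harmonic_cast_mono h
  simpa [harmonic] using this

/-! ### Gain functions and runs along one line. -/

namespace GridOrientation

open Classical Finset

variable {α β : Type*} [Fintype α] [Fintype β] {G : GridOrientation α β}

/-- A function `g` with values between `0` and `H` on a set `Φ` of vertices that is closed under
directed steps. It equals `H` at the vertices with fewer than `m` outgoing edges in each of the
two directions, and at every other vertex it is at least the average over the out-neighbours
minus one. -/
structure Gain (G : GridOrientation α β) (Φ : α → β → Prop) (g : α → β → ℝ) (H : ℝ) (m : ℕ) :
    Prop where
  col_mem : ∀ {i j x}, Φ i j → G.col j i x → Φ x j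
  row_mem : ∀ {i j y}, Φ i j → G.row i j y → Φ i y
  nonneg : ∀ {i j}, Φ i j → 0 ≤ g i j
  le : ∀ {i j}, Φ i j → g i j ≤ H
  eq : ∀ {i j}, Φ i j → #(G.outL i j) < m → #(G.outR i j) < m → g i j = H
  sum_le : ∀ {i j}, Φ i j → ¬ (#(G.outL i j) < m ∧ #(G.outR i j) < m) →
    ∑ x ∈ G.outL i j, g x j + ∑ y ∈ G.outR i j, g i y ≤
      (#(G.outL i j) + #(G.outR i j)) * (g i j + 1)

namespace Gain

variable {Φ : α → β → Prop} {g : α → β → ℝ} {H η : ℝ} {m : ℕ}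

theorem swap (hg : G.Gain Φ g H m) : G.swap.Gain (fun j i => Φ i j) (fun j i => g i j) H m where
  col_mem := hg.row_mem
  row_mem := hg.col_mem
  nonneg := hg.nonneg
  le := hg.le
  eq h1 h2 h3 := hg.eq h1 h3 h2
  sum_le h1 h2 := by
    have := hg.sum_le h1 fun h3 => h2 h3.symm
    simp only [swap_outL, swap_outR]
    linarith

/-- Follow the walk along the line `i` until it enters the `M` lowest vertices, enters `R₀`, or
leaves the line. Before that, `M` moves lead uniformly into the bottom and at most `b + #R₀` moves
are lost, so each bottom vertex is hit with probability at least `1 / (M + b + #R₀)`. The run takes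
at most `harmonic N` steps on average, because each move within the line lands uniformly among lower
vertices. -/
theorem sum_le_of_run (h : G.IsUSO) (hg : G.Gain Φ g H m) {i : α} {R₀ : Finset β} {b M : ℕ} (N : ℕ) :
    ∀ j, #(G.outR i j) = N → Φ i j → j ∉ R₀ →
      (∀ y, y = j ∨ G.row i j y → y ∉ R₀ → #(G.outL i y) ≤ b) → M ≤ N → 0 < M →
      ∑ y with #(G.outR i y) < M, g i y ≤ (M + b + #R₀) * (g i j + (harmonic N : ℝ)) := by
  induction N using Nat.strong_induction_on with
  | _ N ih =>
  intro j hN hΦ hj hb hM hM0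
  set bot : Finset β := {y | #(G.outR i y) < M} with hbot
  have hsub : bot ⊆ G.outR i j := fun y hy => by
    rw [hbot, Finset.mem_filter] at hy
    exact mem_outR.2 (h.card_outR_lt_iff.1 (by omega))
  have hcard : #bot = M := by
    refine h.card_filter_outR_lt i M ?_
    have := Finset.card_le_univ (G.outR i j)
    omega
  have hΦR : ∀ y ∈ G.outR i j, Φ i y := fun y hy => hg.row_mem hΦ (mem_outR.1 hy)
  have hGs : 0 ≤ ∑ y ∈ bot, g i y := Finset.sum_nonneg fun y hy => hg.nonneg (hΦR y (hsub hy))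
  have hD : (0 : ℝ) ≤ M + b + #R₀ := by positivity
  have hH := harmonic_cast_nonneg N
  by_cases hS : #(G.outL i j) < m ∧ #(G.outR i j) < m
  · rw [hg.eq hΦ hS.1 hS.2]
    have h0 : 0 ≤ H := (hg.nonneg hΦ).trans (hg.le hΦ)
    have h1 : ∑ y ∈ bot, g i y ≤ #bot • H :=
      Finset.sum_le_card_nsmul _ _ _ fun y hy => hg.le (hΦR y (hsub hy))
    rw [hcard, nsmul_eq_mul] at h1
    have h2 : (M : ℝ) * H ≤ (M + b + #R₀) * H := by
      refine mul_le_mul_of_nonneg_right ?_ h0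
      have : (0 : ℝ) ≤ b + #R₀ := by positivity
      linarith
    nlinarith [mul_nonneg hD hH]
  have hsum := hg.sum_le hΦ hS
  have hL0 : 0 ≤ ∑ x ∈ G.outL i j, g x j :=
    Finset.sum_nonneg fun x hx => hg.nonneg (hg.col_mem hΦ (mem_outL.1 hx))
  -- `Z` collects the moves that continue the run; lost moves are discarded since the gain is
  -- nonnegative.
  set Z : Finset β := (G.outR i j \ bot) \ R₀ with hZ
  have hZsub : Z ⊆ G.outR i j \ bot := Finset.sdiff_subset
  have hRsum : ∑ y ∈ bot, g i y + ∑ y ∈ Z, g i y ≤ ∑ y ∈ G.outR i j, g i y := by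
    rw [← Finset.sum_sdiff hsub, add_comm]
    exact add_le_add (Finset.sum_le_sum_of_subset_of_nonneg hZsub
      fun y hy _ => hg.nonneg (hΦR y (Finset.mem_sdiff.1 hy).1)) le_rfl
  have hZcard : N ≤ M + #Z + #R₀ := by
    have h1 := Finset.card_sdiff_of_subset hsub
    have h2 := Finset.le_card_sdiff R₀ (G.outR i j \ bot)
    rw [← hZ] at h2
    omega
  have hZle : ∀ y ∈ Z, ∑ y ∈ bot, g i y - (M + b + #R₀) * (harmonic #(G.outR i y) : ℝ) ≤
      (M + b + #R₀) * g i y := by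
    intro y hy
    rw [hZ, Finset.mem_sdiff, Finset.mem_sdiff] at hy
    obtain ⟨⟨hy1, hy2⟩, hy3⟩ := hy
    have hrow := mem_outR.1 hy1
    have := ih _ (hN ▸ h.card_outR_lt hrow) y rfl (hΦR y hy1) hy3
      (fun z hz hz' => hb z (Or.inr (hz.elim (fun e => e ▸ hrow) fun e => h.row_trans hrow e)) hz')
      (by simpa [hbot] using hy2) hM0
    linarith
  have hZsum := Finset.sum_le_sum hZle
  rw [Finset.sum_sub_distrib, Finset.sum_const, nsmul_eq_mul, ← Finset.mul_sum, ← Finset.mul_sum]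
    at hZsum
  -- Out-degrees along a line are distinct, and those in `Z` are below `N`. The summation formula
  -- for harmonic numbers then supplies the missing `- N`, which pays for the step just made.
  have hharm : ∑ y ∈ Z, (harmonic #(G.outR i y) : ℝ) ≤ N * (harmonic N : ℝ) - N := by
    rw [← sum_range_harmonic, ← Finset.sum_image (s := Z) (g := fun y => #(G.outR i y))
      (f := fun n => (harmonic n : ℝ)) fun y _ z _ he => h.card_outR_injective i he]
    refine Finset.sum_le_sum_of_subset_of_nonneg (fun n hn => ?_) fun _ _ _ => harmonic_cast_nonneg _
    obtain ⟨y, hy, rfl⟩ := Finset.mem_image.1 hn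
    rw [Finset.mem_range, ← hN]
    exact h.card_outR_lt (mem_outR.1 (Finset.mem_sdiff.1 (hZsub hy)).1)
  have hl : #(G.outL i j) ≤ b := hb j (Or.inl rfl) hj
  have h1N : (1 : ℝ) ≤ (harmonic N : ℝ) := one_le_harmonic_cast (by omega)
  rw [hN] at hsum
  set Gs := ∑ y ∈ bot, g i y
  set D : ℝ := M + b + #R₀
  set lN : ℝ := #(G.outL i j) + (N : ℝ) with hlN
  have hlNpos : 0 < lN := by
    have : (0 : ℝ) < N := by exact_mod_cast (by omega : 0 < N)
    positivity
  have e1 : lN ≤ D + #Z := by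
    have h1 : (N : ℝ) ≤ M + #Z + #R₀ := by exact_mod_cast hZcard
    have h2 : (#(G.outL i j) : ℝ) ≤ b := by exact_mod_cast hl
    simp only [hlN, D]
    linarith
  have e2 : D * (lN * (g i j + 1)) ≥ D * (Gs + ∑ y ∈ Z, g i y) :=
    mul_le_mul_of_nonneg_left (by linarith) hD
  have e3 := mul_le_mul_of_nonneg_left hharm hD
  have e4 := mul_le_mul_of_nonneg_right e1 hGs
  have e5 : 0 ≤ D * (#(G.outL i j) * ((harmonic N : ℝ) - 1)) :=
    mul_nonneg hD (mul_nonneg (by positivity) (by linarith))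
  refine le_of_mul_le_mul_left ?_ hlNpos
  have e6 : lN * (D * (g i j + (harmonic N : ℝ))) =
      D * (lN * (g i j + 1)) + D * (#(G.outL i j) * ((harmonic N : ℝ) - 1)) +
        D * (N * (harmonic N : ℝ) - N) := by
    rw [hlN]; ring
  rw [e6]
  nlinarith

end Gain

end GridOrientation

/-! ### Counting targets with both out-degrees below `m`. -/

namespace GridOrientation

open Classical Finset

variable {α β : Type*} {G : GridOrientation α β}

theorem IsUSO.card_filter_lt (h : G.IsUSO) {A : Finset α} {i : α} (hi : i ∈ A) (j : β) :
    #{x ∈ A | G.col j i x} < #A :=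
  Finset.card_lt_card (Finset.filter_ssubset.2 ⟨i, hi, h.col_irrefl _ _⟩)

theorem IsUSO.card_index_lt_eq_min (h : G.IsUSO) (A : Finset α) (B : Finset β) (k s : ℕ) :
    #{p ∈ A ×ˢ B | #{x ∈ A | G.col p.2 p.1 x} < k ∧ #{y ∈ B | G.row p.1 p.2 y} < s} =
      min k #A * min s #B := by
  rw [← h.card_index_lt A B _ _ (min_le_right k #A) (min_le_right s #B)]
  congr 1
  refine Finset.filter_congr fun p hp => ?_
  rw [Finset.mem_product] at hp
  have h1 := h.card_filter_lt hp.1 p.2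
  have h2 : #{y ∈ B | G.row p.1 p.2 y} < #B := h.swap.card_filter_lt hp.2 p.1
  rw [lt_min_iff, lt_min_iff]
  tauto

variable [Fintype α] [Fintype β]

/-- The out-neighbours `x` of `i` in column `j` for which `(x, j)` has fewer than `m` outgoing edges
in the second direction only. -/
noncomputable def critical (G : GridOrientation α β) (m : ℕ) (i : α) (j : β) : Finset α :=
  {x ∈ G.outL i j | #(G.outR x j) < m ∧ m ≤ #(G.outL x j)}

/-- A lower bound, up to a factor, for the probability that a walk from `(x, j)` that keeps the
first coordinate reaches a vertex with fewer than `m` outgoing edges in each direction. -/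
noncomputable def weight (G : GridOrientation α β) (m : ℕ) (x : α) (j : β) : ℕ :=
  if #(G.outR x j) < m then if #(G.outL x j) < m then m else 0
  else #{y | #(G.outR x y) < m ∧ #(G.outL x y) < m}

/-- The vertices `(x, y)` with `x` an out-neighbour of `i₀` that have at least `m` outgoing edges in
the first direction, but fewer than `m` of them inside the rows of these out-neighbours. -/
noncomputable def bad (G : GridOrientation α β) (m : ℕ) (i₀ : α) (j₀ : β) : Finset (α × β) :=
  {p ∈ G.outL i₀ j₀ ×ˢ Finset.univ | m ≤ #(G.outR p.1 j₀) ∧ #(G.outR p.1 p.2) < m ∧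
    #{x ∈ G.outL i₀ j₀ | G.col p.2 p.1 x} < m ∧ m ≤ #(G.outL p.1 p.2)}

/-- The left side counts the vertices of `outL i₀ j₀ × β` whose two out-degrees inside this subgrid
are below `m`. Each `x` contributes at most `m` of them, and those not accounted for by its weight
are charged to `critical` or `bad`. -/
theorem IsUSO.le_sum_weight_add (h : G.IsUSO) (m : ℕ) (i₀ : α) (j₀ : β) :
    min m #(G.outL i₀ j₀) * min m (Fintype.card β) ≤
      ∑ x ∈ G.outL i₀ j₀, G.weight m x j₀ + m * #(G.critical m i₀ j₀) + #(G.bad m i₀ j₀) := by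
  rw [← Finset.card_univ, ← h.card_index_lt_eq_min, critical, bad, Finset.card_filter,
    Finset.card_filter, Finset.card_filter, Finset.sum_product, Finset.sum_product, Finset.mul_sum,
    ← Finset.sum_add_distrib, ← Finset.sum_add_distrib]
  refine Finset.sum_le_sum fun x hx => ?_
  dsimp only
  have hle : ∑ y : β, (if #{x' ∈ G.outL i₀ j₀ | G.col y x x'} < m ∧ #{y' | G.row x y y'} < m
      then 1 else 0) ≤ m := by
    rw [← Finset.card_filter]
    exact (Finset.card_le_card fun y hy => Finset.mem_filter.2
      ⟨Finset.mem_univ _, (Finset.mem_filter.1 hy).2.2⟩).trans (h.card_filter_outR_lt_le x m)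
  by_cases h1 : #(G.outR x j₀) < m
  · by_cases h2 : #(G.outL x j₀) < m
    · rw [weight, if_pos h1, if_pos h2]
      omega
    · rw [weight, if_pos h1, if_neg h2, if_pos ⟨h1, by omega⟩]
      omega
  · rw [weight, if_neg h1, Finset.card_filter]
    have : ∀ y : β, (if #{x' ∈ G.outL i₀ j₀ | G.col y x x'} < m ∧ #{y' | G.row x y y'} < m
      then 1 else 0) ≤ (if #(G.outR x y) < m ∧ #(G.outL x y) < m then 1 else 0) +
        if m ≤ #(G.outR x j₀) ∧ #(G.outR x y) < m ∧
          #{x' ∈ G.outL i₀ j₀ | G.col y x x'} < m ∧ m ≤ #(G.outL x y) then 1 else 0 := by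
      intro y
      rw [show #{y' | G.row x y y'} = #(G.outR x y) from rfl]
      by_cases h3 : #(G.outL x y) < m
      · split_ifs <;> omega
      · split_ifs <;> omega
    have := Finset.sum_le_sum fun y (_ : y ∈ Finset.univ) => this y
    rw [Finset.sum_add_distrib] at this
    omega

/-- For a bad `(x, y)` with `y` outside `outR i₀ j₀`, confinement puts all of `outL x y` inside
`outL i₀ j₀`. The small restricted out-degree would then be the full one, which is large. -/
theorem IsUSO.bad_subset (h : G.IsUSO) {m : ℕ} {i₀ : α} {j₀ : β} :
    G.bad m i₀ j₀ ⊆ {p ∈ G.outL i₀ j₀ ×ˢ G.outR i₀ j₀ |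
      #{x ∈ G.outL i₀ j₀ | G.col p.2 p.1 x} < m ∧ #{y ∈ G.outR i₀ j₀ | G.row p.1 p.2 y} < m} := by
  rintro ⟨x, y⟩ hp
  simp only [bad, Finset.mem_filter, Finset.mem_product, Finset.mem_univ, and_true] at hp
  obtain ⟨hx, h1, h2, h3, h4⟩ := hp
  have hrow : G.row x j₀ y := h.card_outR_lt_iff.1 (by omega)
  have hr : Relation.ReflTransGen G.Step (i₀, j₀) (x, y) :=
    (Relation.ReflTransGen.single (.of_col (mem_outL.1 hx))).tail (.of_row hrow)
  have hy : y ∈ G.outR i₀ j₀ := by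
    by_contra hy
    have h5 := h.outL_subset_of_notMem hr hy
    have h6 : G.outL x y ⊆ {x' ∈ G.outL i₀ j₀ | G.col y x x'} := fun z hz =>
      Finset.mem_filter.2 ⟨h5 hz, mem_outL.1 hz⟩
    have := Finset.card_le_card h6
    omega
  simp only [Finset.mem_filter, Finset.mem_product]
  refine ⟨⟨hx, hy⟩, h3, lt_of_le_of_lt (Finset.card_le_card fun z hz => ?_) h2⟩
  exact mem_outR.2 (Finset.mem_filter.1 hz).2

/-- The bad vertices of the two directions lie in the same set of low-index vertices of `outL ×
outR`. They are disjoint, because the first kind has out-degree at least `m` in the first direction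
and the second kind has it below `m`. -/
theorem IsUSO.card_bad_add_card_bad_swap_le (h : G.IsUSO) (m : ℕ) (i₀ : α) (j₀ : β) :
    #(G.bad m i₀ j₀) + #(G.swap.bad m j₀ i₀) ≤ min m #(G.outL i₀ j₀) * min m #(G.outR i₀ j₀) := by
  rw [← h.card_index_lt_eq_min, ← Finset.card_image_of_injective (G.swap.bad m j₀ i₀)
    Prod.swap_injective, ← Finset.card_union_of_disjoint]
  · refine Finset.card_le_card (Finset.union_subset h.bad_subset fun p hp => ?_)
    obtain ⟨q, hq, rfl⟩ := Finset.mem_image.1 hp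
    have := h.swap.bad_subset hq
    rw [Finset.mem_filter, Finset.mem_product] at this ⊢
    exact ⟨this.1.symm, this.2.symm⟩
  · rw [Finset.disjoint_left]
    rintro ⟨x, y⟩ hp hp'
    obtain ⟨⟨y', x'⟩, hq, he⟩ := Finset.mem_image.1 hp'
    obtain ⟨rfl, rfl⟩ : x' = x ∧ y' = y := by simpa using he
    rw [bad, Finset.mem_filter] at hp hq
    exact absurd hp.2.2.2.2 (not_le.2 hq.2.2.1)

theorem IsUSO.sq_le_sum_weight_of_card_le (h : G.IsUSO) {m : ℕ} {i₀ : α} {j₀ : β}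
    (hS : ¬ (#(G.outL i₀ j₀) < m ∧ #(G.outR i₀ j₀) < m)) (hβ : Fintype.card β ≤ m) :
    m * m ≤ ∑ x ∈ G.outL i₀ j₀, G.weight m x j₀ := by
  have hR : ∀ x, #(G.outR x j₀) < m := fun x =>
    lt_of_lt_of_le (h.swap.card_filter_lt (Finset.mem_univ j₀) x) hβ
  have hl : m ≤ #(G.outL i₀ j₀) := by
    by_contra hlt
    exact hS ⟨by omega, hR _⟩
  have hsub : ({x | #(G.outL x j₀) < m} : Finset α) ⊆ G.outL i₀ j₀ := fun x hx => by
    rw [Finset.mem_filter] at hx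
    exact mem_outL.2 (h.swap.card_outR_lt_iff.1 (lt_of_lt_of_le hx.2 hl))
  have hc : #{x | #(G.outL x j₀) < m} = m :=
    h.swap.card_filter_outR_lt j₀ m (hl.trans (Finset.card_le_univ _))
  calc m * m = ∑ x with #(G.outL x j₀) < m, m := by rw [Finset.sum_const, hc, smul_eq_mul]
    _ = ∑ x with #(G.outL x j₀) < m, G.weight m x j₀ :=
      Finset.sum_congr rfl fun x hx => by
        rw [weight, if_pos (hR x), if_pos (Finset.mem_filter.1 hx).2]
    _ ≤ _ := Finset.sum_le_sum_of_subset hsub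

/-- Adding the counts for both directions and subtracting the shared bound for the bad vertices
leaves exactly `m * m`, since one of the two out-degrees is at least `m`. The critical vertices cost
at most half of this. A side of length at most `m` is treated separately. -/
theorem IsUSO.sq_le_two_mul_sum_weight (h : G.IsUSO) {m : ℕ} {i₀ : α} {j₀ : β}
    (hS : ¬ (#(G.outL i₀ j₀) < m ∧ #(G.outR i₀ j₀) < m))
    (hT : 4 * #(G.critical m i₀ j₀) ≤ m) (hT' : 4 * #(G.swap.critical m j₀ i₀) ≤ m) :
    m * m ≤ 2 * (∑ x ∈ G.outL i₀ j₀, G.weight m x j₀ +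
      ∑ y ∈ G.outR i₀ j₀, G.swap.weight m y i₀) := by
  rcases le_or_gt (Fintype.card β) m with hβ | hβ
  · have := h.sq_le_sum_weight_of_card_le hS hβ
    omega
  rcases le_or_gt (Fintype.card α) m with hα | hα
  · have := h.swap.sq_le_sum_weight_of_card_le (i₀ := j₀) (j₀ := i₀) (fun h1 => hS h1.symm) hα
    rw [swap_outL] at this
    omega
  have h1 := h.le_sum_weight_add m i₀ j₀
  have h2 := h.swap.le_sum_weight_add m j₀ i₀
  have h3 := h.card_bad_add_card_bad_swap_le m i₀ j₀
  rw [min_eq_left hβ.le] at h1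
  rw [min_eq_left hα.le, swap_outL] at h2
  have h4 := Nat.mul_le_mul_left m hT
  have h5 := Nat.mul_le_mul_left m hT'
  have h6 : m * m + min m #(G.outL i₀ j₀) * min m #(G.outR i₀ j₀) =
      min m #(G.outL i₀ j₀) * m + min m #(G.outR i₀ j₀) * m := by
    rcases not_and_or.1 hS with h7 | h7
    · rw [min_eq_left (by omega : m ≤ #(G.outL i₀ j₀))]
      ring
    · rw [min_eq_left (by omega : m ≤ #(G.outR i₀ j₀))]
      ring
  rw [show m * (4 * #(G.critical m i₀ j₀)) = 4 * (m * #(G.critical m i₀ j₀)) by ring] at h4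
  rw [show m * (4 * #(G.swap.critical m j₀ i₀)) = 4 * (m * #(G.swap.critical m j₀ i₀)) by ring] at h5
  omega

/-- A line is linearly ordered, so the lowest `m / 4 + 1` critical vertices have at most `m / 4`
critical vertices below them. -/
theorem IsUSO.le_card_filter_critical (h : G.IsUSO) {m : ℕ} {i : α} {j : β}
    (hT : m < 4 * #(G.critical m i j)) :
    m ≤ 4 * #{x ∈ G.critical m i j | 4 * #{z ∈ G.critical m i j | G.col j x z} ≤ m} := by
  have h1 := h.card_index_lt (G.critical m i j) {j} (m / 4 + 1) 1 (by omega) (by simp)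
  have h2 : #{p ∈ G.critical m i j ×ˢ {j} | #{x ∈ G.critical m i j | G.col p.2 p.1 x} < m / 4 + 1 ∧
      #{y ∈ ({j} : Finset β) | G.row p.1 p.2 y} < 1} ≤
      #{x ∈ G.critical m i j | 4 * #{z ∈ G.critical m i j | G.col j x z} ≤ m} := by
    refine Finset.card_le_card_of_injOn Prod.fst ?_ ?_
    · rintro ⟨x, y⟩ hp
      rw [Finset.mem_coe, Finset.mem_filter, Finset.mem_product, Finset.mem_singleton] at hp
      obtain ⟨⟨hx, rfl⟩, h3, -⟩ := hp
      simp only [Finset.coe_filter, Set.mem_ofPred_eq]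
      exact ⟨hx, by simp only at h3 hx ⊢; omega⟩
    · rintro ⟨x, y⟩ hp ⟨x', y'⟩ hp' he
      rw [Finset.mem_coe, Finset.mem_filter, Finset.mem_product, Finset.mem_singleton] at hp hp'
      exact Prod.ext he (hp.1.2.trans hp'.1.2.symm)
  omega

/-! ### Lower bounds for the gain. -/

namespace Gain

variable {Φ : α → β → Prop} {g : α → β → ℝ} {H η : ℝ} {m : ℕ}

/-- In the nontrivial case this is a run from `(x, j₀)` to the lowest `m` vertices of its line,
avoiding `outR i₀ j₀`. Confinement bounds the sideways moves by `4 * m`, so the denominator is at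
most `m + 4 * m + 4 * m`. -/
theorem mul_weight_le (h : G.IsUSO) (hg : G.Gain Φ g H m) (hm : 0 < m)
    (hη : (harmonic (Fintype.card β) : ℝ) ≤ η) {i₀ x : α} {j₀ : β} (hΦ : Φ i₀ j₀)
    (hl : #(G.outL i₀ j₀) ≤ 4 * m) (hr : #(G.outR i₀ j₀) ≤ 4 * m) (hx : x ∈ G.outL i₀ j₀) :
    H * G.weight m x j₀ ≤ 9 * m * (g x j₀ + η) := by
  have hx' := mem_outL.1 hx
  have hΦx : Φ x j₀ := hg.col_mem hΦ hx'
  have h0 := hg.nonneg hΦx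
  have hH : 0 ≤ H := h0.trans (hg.le hΦx)
  have hη0 : 0 ≤ η := (harmonic_cast_nonneg _).trans hη
  have hmR : (0 : ℝ) < m := by exact_mod_cast hm
  by_cases h1 : #(G.outR x j₀) < m
  · by_cases h2 : #(G.outL x j₀) < m
    · rw [weight, if_pos h1, if_pos h2, hg.eq hΦx h2 h1]
      nlinarith [mul_nonneg hmR.le hH, mul_nonneg hmR.le hη0]
    · rw [weight, if_pos h1, if_neg h2, Nat.cast_zero, mul_zero]
      positivity
  · rw [weight, if_neg h1]
    have hreach : ∀ y, y = j₀ ∨ G.row x j₀ y →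
        Relation.ReflTransGen G.Step (i₀, j₀) (x, y) := by
      rintro y (rfl | hy)
      · exact .single (.of_col hx')
      · exact (Relation.ReflTransGen.single (.of_col hx')).tail (.of_row hy)
    have hrun := hg.sum_le_of_run h (i := x) (R₀ := G.outR i₀ j₀) (b := 4 * m) (M := m) _ j₀ rfl hΦx
      (fun hj => h.row_irrefl _ _ (mem_outR.1 hj))
      (fun y hy hy' => (Finset.card_le_card (h.outL_subset_of_notMem (hreach y hy) hy')).trans hl)
      (by omega) hm
    have hsum : H * #{y | #(G.outR x y) < m ∧ #(G.outL x y) < m} ≤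
        ∑ y with #(G.outR x y) < m, g x y := by
      have hΦy : ∀ y, #(G.outR x y) < m → Φ x y := fun y hy =>
        hg.row_mem hΦx (h.card_outR_lt_iff.1 (by omega))
      calc H * #{y | #(G.outR x y) < m ∧ #(G.outL x y) < m}
          = ∑ y with #(G.outR x y) < m ∧ #(G.outL x y) < m, H := by
            rw [Finset.sum_const, nsmul_eq_mul, mul_comm]
        _ = ∑ y with #(G.outR x y) < m ∧ #(G.outL x y) < m, g x y :=
            Finset.sum_congr rfl fun y hy => by
              obtain ⟨h3, h4⟩ := (Finset.mem_filter.1 hy).2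
              exact (hg.eq (hΦy y h3) h4 h3).symm
        _ ≤ _ := by
            refine Finset.sum_le_sum_of_subset_of_nonneg (fun y hy => ?_) fun y hy _ => ?_
            · exact Finset.mem_filter.2 ⟨Finset.mem_univ _, (Finset.mem_filter.1 hy).2.1⟩
            · exact hg.nonneg (hΦy y (Finset.mem_filter.1 hy).2)
    refine hsum.trans (hrun.trans ?_)
    have h5 : (harmonic #(G.outR x j₀) : ℝ) ≤ η :=
      (harmonic_cast_mono (Finset.card_le_univ _)).trans hη
    have h6 := harmonic_cast_nonneg #(G.outR x j₀)
    have h7 : ((m : ℝ) + (4 * m : ℕ) + #(G.outR i₀ j₀)) ≤ 9 * m := by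
      have : (#(G.outR i₀ j₀) : ℝ) ≤ 4 * m := by exact_mod_cast hr
      push_cast
      linarith
    exact mul_le_mul h7 (by linarith) (by linarith) (by positivity)

/-- One step followed by a run: the weights of the out-neighbours total at least `m * m / 2`, there
are at most `8 * m` out-neighbours, and each run loses a factor `9 * m`. Hence `144 = 2 * 9 * 8`. -/
theorem le_of_critical_le (h : G.IsUSO) (hg : G.Gain Φ g H m) (hm : 0 < m)
    (hα : (harmonic (Fintype.card α) : ℝ) ≤ η) (hβ : (harmonic (Fintype.card β) : ℝ) ≤ η)
    {i₀ : α} {j₀ : β} (hΦ : Φ i₀ j₀)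
    (hl : #(G.outL i₀ j₀) ≤ 4 * m) (hr : #(G.outR i₀ j₀) ≤ 4 * m)
    (hT : 4 * #(G.critical m i₀ j₀) ≤ m) (hT' : 4 * #(G.swap.critical m j₀ i₀) ≤ m) :
    H ≤ 144 * (g i₀ j₀ + 1 + η) := by
  have hη0 : 0 ≤ η := (harmonic_cast_nonneg _).trans hα
  have h0 := hg.nonneg hΦ
  by_cases hS : #(G.outL i₀ j₀) < m ∧ #(G.outR i₀ j₀) < m
  · rw [← hg.eq hΦ hS.1 hS.2]
    linarith
  have hH : 0 ≤ H := h0.trans (hg.le hΦ)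
  have hmR : (0 : ℝ) < m := by exact_mod_cast hm
  have hw := h.sq_le_two_mul_sum_weight hS hT hT'
  have h1 := Finset.sum_le_sum fun x hx => hg.mul_weight_le h hm hβ hΦ hl hr (x := x) hx
  have h2 : ∑ y ∈ G.outR i₀ j₀, H * (G.swap.weight m y i₀ : ℝ) ≤
      ∑ y ∈ G.outR i₀ j₀, 9 * m * (g i₀ y + η) :=
    Finset.sum_le_sum fun y hy => hg.swap.mul_weight_le h.swap hm hα hΦ hr hl (x := y) hy
  have h3 := hg.sum_le hΦ hS
  rw [← Finset.mul_sum, ← Finset.mul_sum, Finset.sum_add_distrib, Finset.sum_const, nsmul_eq_mul]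
    at h1 h2
  have hw' : (m : ℝ) * m ≤ 2 * (∑ x ∈ G.outL i₀ j₀, (G.weight m x j₀ : ℝ) +
      ∑ y ∈ G.outR i₀ j₀, (G.swap.weight m y i₀ : ℝ)) := by exact_mod_cast hw
  have h4 := mul_le_mul_of_nonneg_left hw' hH
  set c : ℝ := #(G.outL i₀ j₀) + #(G.outR i₀ j₀) with hc
  have hc8 : c ≤ 8 * m := by
    have e1 : (#(G.outL i₀ j₀) : ℝ) ≤ 4 * m := by exact_mod_cast hl
    have e2 : (#(G.outR i₀ j₀) : ℝ) ≤ 4 * m := by exact_mod_cast hr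
    linarith
  have h5 : H * (m * m) ≤ 18 * m * (c * (g i₀ j₀ + 1 + η)) := by
    have : 18 * m * (∑ x ∈ G.outL i₀ j₀, g x j₀ + ∑ y ∈ G.outR i₀ j₀, g i₀ y) ≤
        18 * m * (c * (g i₀ j₀ + 1)) := mul_le_mul_of_nonneg_left h3 (by positivity)
    have e3 : 18 * m * (c * (g i₀ j₀ + 1 + η)) = 18 * m * (c * (g i₀ j₀ + 1)) +
      18 * m * (#(G.outL i₀ j₀) * η) + 18 * m * (#(G.outR i₀ j₀) * η) := by rw [hc]; ring
    rw [e3]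
    linarith
  have h6 : 18 * m * (c * (g i₀ j₀ + 1 + η)) ≤ 18 * m * (8 * m * (g i₀ j₀ + 1 + η)) :=
    mul_le_mul_of_nonneg_left (mul_le_mul_of_nonneg_right hc8 (by linarith)) (by positivity)
  refine le_of_mul_le_mul_right ?_ (mul_pos hmR hmR)
  linarith

/-- With many critical out-neighbours, the first step reaches with probability at least `1 / 32` one
of the lowest among them, where `le_of_critical_le` applies. Hence `4608 = 32 * 144`. -/
theorem le_of_lt_critical (h : G.IsUSO) (hg : G.Gain Φ g H m) (hm : 0 < m)
    (hα : (harmonic (Fintype.card α) : ℝ) ≤ η) (hβ : (harmonic (Fintype.card β) : ℝ) ≤ η)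
    (hη : 1 ≤ η) {i₀ : α} {j₀ : β} (hΦ : Φ i₀ j₀)
    (hl : #(G.outL i₀ j₀) ≤ 4 * m) (hr : #(G.outR i₀ j₀) ≤ 4 * m)
    (hT : m < 4 * #(G.critical m i₀ j₀)) : H ≤ 4608 * (g i₀ j₀ + 2 * η) := by
  have h0 := hg.nonneg hΦ
  have hmR : (0 : ℝ) < m := by exact_mod_cast hm
  by_cases hS : #(G.outL i₀ j₀) < m ∧ #(G.outR i₀ j₀) < m
  · rw [← hg.eq hΦ hS.1 hS.2]
    linarith
  set low : Finset α :=
    {x ∈ G.critical m i₀ j₀ | 4 * #{z ∈ G.critical m i₀ j₀ | G.col j₀ x z} ≤ m} with hlow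
  have hlowcard : m ≤ 4 * #low := h.le_card_filter_critical hT
  have hsub : low ⊆ G.outL i₀ j₀ :=
    (Finset.filter_subset _ _).trans (Finset.filter_subset _ _)
  have hnice : ∀ x ∈ low, H / 144 - 2 * η ≤ g x j₀ := by
    intro x hx
    have hcol := mem_outL.1 (hsub hx)
    have hx1 := Finset.mem_filter.1 hx
    have hx2 := (Finset.mem_filter.1 hx1.1).2
    have hLx := Finset.card_le_card (h.outL_subset hcol)
    have := hg.le_of_critical_le h hm hα hβ (hg.col_mem hΦ hcol) (by omega) (by omega) ?_ ?_
    · linarith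
    · refine le_trans (Nat.mul_le_mul_left 4 (Finset.card_le_card fun z hz => ?_)) hx1.2
      have hz1 := Finset.mem_filter.1 hz
      exact Finset.mem_filter.2 ⟨Finset.mem_filter.2 ⟨h.outL_subset hcol hz1.1, hz1.2⟩,
        mem_outL.1 hz1.1⟩
    -- The out-degree of `(x, j₀)` in the second direction is already below `m` and decreases along
    -- the line, so no critical vertex in the other direction can remain.
    · have : G.swap.critical m j₀ x = ∅ := by
        refine Finset.filter_eq_empty_iff.2 fun y hy hy' => ?_
        have h1 := h.card_outR_lt (mem_outR.1 hy)
        exact absurd hy'.2 (not_le.2 (h1.trans hx2.1))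
      rw [this]
      simp
  rcases le_or_gt (H / 144 - 2 * η) 0 with hneg | hpos
  · linarith
  have h1 := hg.sum_le hΦ hS
  have h2 : #low * (H / 144 - 2 * η) ≤ ∑ x ∈ G.outL i₀ j₀, g x j₀ := by
    rw [← nsmul_eq_mul]
    exact (Finset.card_nsmul_le_sum _ _ _ hnice).trans
      (Finset.sum_le_sum_of_subset_of_nonneg hsub
        fun x hx _ => hg.nonneg (hg.col_mem hΦ (mem_outL.1 hx)))
  have h3 : 0 ≤ ∑ y ∈ G.outR i₀ j₀, g i₀ y :=
    Finset.sum_nonneg fun y hy => hg.nonneg (hg.row_mem hΦ (mem_outR.1 hy))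
  have h4 : (m : ℝ) ≤ 4 * #low := by exact_mod_cast hlowcard
  have h5 := mul_le_mul_of_nonneg_right h4 hpos.le
  have h6 : ((#(G.outL i₀ j₀) : ℝ) + #(G.outR i₀ j₀)) * (g i₀ j₀ + 1) ≤ 8 * m * (g i₀ j₀ + 1) := by
    refine mul_le_mul_of_nonneg_right ?_ (by linarith)
    have e1 : (#(G.outL i₀ j₀) : ℝ) ≤ 4 * m := by exact_mod_cast hl
    have e2 : (#(G.outR i₀ j₀) : ℝ) ≤ 4 * m := by exact_mod_cast hr
    linarith
  have h7 : H / 144 - 2 * η ≤ 32 * (g i₀ j₀ + 1) := by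
    refine le_of_mul_le_mul_left ?_ hmR
    linarith
  linarith

theorem le_of_le (h : G.IsUSO) (hg : G.Gain Φ g H m) (hm : 0 < m)
    (hα : (harmonic (Fintype.card α) : ℝ) ≤ η) (hβ : (harmonic (Fintype.card β) : ℝ) ≤ η)
    (hη : 1 ≤ η) {i₀ : α} {j₀ : β} (hΦ : Φ i₀ j₀)
    (hl : #(G.outL i₀ j₀) ≤ 4 * m) (hr : #(G.outR i₀ j₀) ≤ 4 * m) :
    H ≤ 4608 * (g i₀ j₀ + 2 * η) := by
  rcases lt_or_ge m (4 * #(G.critical m i₀ j₀)) with hT | hT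
  · exact hg.le_of_lt_critical h hm hα hβ hη hΦ hl hr hT
  rcases lt_or_ge m (4 * #(G.swap.critical m j₀ i₀)) with hT' | hT'
  · exact hg.swap.le_of_lt_critical h.swap hm hβ hα hη hΦ hr hl hT'
  have := hg.le_of_critical_le h hm hα hβ hΦ hl hr hT hT'
  have h0 := hg.nonneg hΦ
  linarith

variable {i₀ : α} {j₀ : β}

/-- Confinement keeps the first out-degree at most `2 * m` outside `outR i₀ j₀`. If the second
exceeds `4 * m`, run to the lowest `4 * m` vertices of the line: at least `2 * m` of them avoid
`outR i₀ j₀` and are covered by `le_of_le`, while the denominator is at most `8 * m`. -/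
theorem le_of_notMem (h : G.IsUSO)
    (hg : G.Gain (fun i j => Relation.ReflTransGen G.Step (i₀, j₀) (i, j)) g H m) (hm : 0 < m)
    (hα : (harmonic (Fintype.card α) : ℝ) ≤ η) (hβ : (harmonic (Fintype.card β) : ℝ) ≤ η)
    (hη : 1 ≤ η) (hl : #(G.outL i₀ j₀) ≤ 2 * m) (hr : #(G.outR i₀ j₀) ≤ 2 * m) {i : α} {j : β}
    (hΦ : Relation.ReflTransGen G.Step (i₀, j₀) (i, j)) (hj : j ∉ G.outR i₀ j₀) :
    H / 4608 - 2 * η ≤ 4 * (g i j + η) := by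
  have h0 := hg.nonneg hΦ
  have hmR : (0 : ℝ) < m := by exact_mod_cast hm
  have hL : ∀ {y}, Relation.ReflTransGen G.Step (i₀, j₀) (i, y) → y ∉ G.outR i₀ j₀ →
      #(G.outL i y) ≤ 2 * m := fun hy hy' =>
    (Finset.card_le_card (h.outL_subset_of_notMem hy hy')).trans hl
  rcases le_or_gt #(G.outR i j) (4 * m) with hR | hR
  · have := hg.le_of_le h hm hα hβ hη hΦ ((hL hΦ hj).trans (by omega)) hR
    linarith
  rcases le_or_gt (H / 4608 - 2 * η) 0 with hneg | hpos
  · linarith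
  have hrow : ∀ y, #(G.outR i y) < 4 * m → Relation.ReflTransGen G.Step (i₀, j₀) (i, y) :=
    fun y hy => hg.row_mem hΦ (h.card_outR_lt_iff.1 (by omega))
  have hrun := hg.sum_le_of_run h (i := i) (R₀ := G.outR i₀ j₀) (b := 2 * m) (M := 4 * m) _ j rfl hΦ
    hj (fun y hy hy' => hL (hy.elim (fun e => e ▸ hΦ) fun e => hg.row_mem hΦ e) hy')
    (by omega) (by omega)
  have hcard : #{y | #(G.outR i y) < 4 * m} = 4 * m :=
    h.card_filter_outR_lt i _ (hR.le.trans (Finset.card_le_univ _))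
  have hcard' : 2 * m ≤ #(({y | #(G.outR i y) < 4 * m} : Finset β) \ G.outR i₀ j₀) := by
    have := Finset.le_card_sdiff (G.outR i₀ j₀) ({y | #(G.outR i y) < 4 * m} : Finset β)
    omega
  have hsum : (2 * m : ℕ) * (H / 4608 - 2 * η) ≤ ∑ y with #(G.outR i y) < 4 * m, g i y := by
    calc ((2 * m : ℕ) : ℝ) * (H / 4608 - 2 * η)
        ≤ #(({y | #(G.outR i y) < 4 * m} : Finset β) \ G.outR i₀ j₀) * (H / 4608 - 2 * η) :=
          mul_le_mul_of_nonneg_right (by exact_mod_cast hcard') hpos.le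
      _ ≤ ∑ y ∈ ({y | #(G.outR i y) < 4 * m} : Finset β) \ G.outR i₀ j₀, g i y := by
          rw [← nsmul_eq_mul]
          refine Finset.card_nsmul_le_sum _ _ _ fun y hy => ?_
          rw [Finset.mem_sdiff, Finset.mem_filter] at hy
          have hy1 := hrow y hy.1.2
          have := hg.le_of_le h hm hα hβ hη hy1 ((hL hy1 hy.2).trans (by omega)) hy.1.2.le
          linarith
      _ ≤ _ := Finset.sum_le_sum_of_subset_of_nonneg Finset.sdiff_subset
          fun y hy _ => hg.nonneg (hrow y (Finset.mem_filter.1 hy).2)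
  have h5 : (harmonic #(G.outR i j) : ℝ) ≤ η :=
    (harmonic_cast_mono (Finset.card_le_univ _)).trans hβ
  have h6 := harmonic_cast_nonneg #(G.outR i j)
  have h7 : (((4 * m : ℕ) : ℝ) + (2 * m : ℕ) + #(G.outR i₀ j₀)) ≤ 8 * m := by
    have : (#(G.outR i₀ j₀) : ℝ) ≤ 2 * m := by exact_mod_cast hr
    push_cast
    linarith
  have h8 : (((4 * m : ℕ) : ℝ) + (2 * m : ℕ) + #(G.outR i₀ j₀)) *
      (g i j + (harmonic #(G.outR i j) : ℝ)) ≤ 8 * m * (g i j + η) :=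
    mul_le_mul h7 (by linarith) (by linarith) (by positivity)
  refine le_of_mul_le_mul_left ?_ hmR
  push_cast at hsum
  push_cast at h8 hrun
  linarith

/-- When the second out-degree exceeds `4 * m`, at least half of these out-neighbours lie outside
`outR i₀ j₀`. They make up at least a quarter of all out-neighbours, and `le_of_notMem` applies to
them, giving `16 = 4 * 4`. -/
theorem le_of_card_le (h : G.IsUSO)
    (hg : G.Gain (fun i j => Relation.ReflTransGen G.Step (i₀, j₀) (i, j)) g H m) (hm : 0 < m)
    (hα : (harmonic (Fintype.card α) : ℝ) ≤ η) (hβ : (harmonic (Fintype.card β) : ℝ) ≤ η)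
    (hη : 1 ≤ η) (hl : #(G.outL i₀ j₀) ≤ 2 * m) (hr : #(G.outR i₀ j₀) ≤ 2 * m) {i : α} {j : β}
    (hΦ : Relation.ReflTransGen G.Step (i₀, j₀) (i, j)) (hle : #(G.outL i j) ≤ #(G.outR i j)) :
    H / 4608 - 2 * η ≤ 16 * (g i j + 2 * η) := by
  have h0 := hg.nonneg hΦ
  rcases le_or_gt #(G.outR i j) (4 * m) with hR | hR
  · have := hg.le_of_le h hm hα hβ hη hΦ (hle.trans hR) hR
    linarith
  rcases le_or_gt ((H / 4608 - 2 * η) / 4 - η) 0 with hneg | hpos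
  · linarith
  have hsum : ((#(G.outR i j) : ℝ) / 2) * ((H / 4608 - 2 * η) / 4 - η) ≤
      ∑ y ∈ G.outR i j, g i y := by
    have hcard : #(G.outR i j) ≤ 2 * #(G.outR i j \ G.outR i₀ j₀) := by
      have := Finset.le_card_sdiff (G.outR i₀ j₀) (G.outR i j)
      omega
    have hcard' : (#(G.outR i j) : ℝ) ≤ 2 * #(G.outR i j \ G.outR i₀ j₀) := by
      exact_mod_cast hcard
    calc ((#(G.outR i j) : ℝ) / 2) * ((H / 4608 - 2 * η) / 4 - η)
        ≤ #(G.outR i j \ G.outR i₀ j₀) * ((H / 4608 - 2 * η) / 4 - η) :=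
          mul_le_mul_of_nonneg_right (by linarith) hpos.le
      _ ≤ ∑ y ∈ G.outR i j \ G.outR i₀ j₀, g i y := by
          rw [← nsmul_eq_mul]
          refine Finset.card_nsmul_le_sum _ _ _ fun y hy => ?_
          rw [Finset.mem_sdiff, mem_outR] at hy
          have := hg.le_of_notMem h hm hα hβ hη hl hr (hg.row_mem hΦ hy.1) hy.2
          linarith
      _ ≤ _ := Finset.sum_le_sum_of_subset_of_nonneg Finset.sdiff_subset
          fun y hy _ => hg.nonneg (hg.row_mem hΦ (mem_outR.1 hy))
  have hL0 : 0 ≤ ∑ x ∈ G.outL i j, g x j :=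
    Finset.sum_nonneg fun x hx => hg.nonneg (hg.col_mem hΦ (mem_outL.1 hx))
  have h1 := hg.sum_le hΦ (by omega)
  have hrpos : (0 : ℝ) < #(G.outR i j) := by exact_mod_cast (by omega : 0 < #(G.outR i j))
  have h2 : ((#(G.outL i j) : ℝ) + #(G.outR i j)) * (g i j + 1) ≤
      2 * #(G.outR i j) * (g i j + 1) := by
    refine mul_le_mul_of_nonneg_right ?_ (by linarith)
    have : (#(G.outL i j) : ℝ) ≤ #(G.outR i j) := by exact_mod_cast hle
    linarith
  have h3 : ((H / 4608 - 2 * η) / 4 - η) ≤ 4 * (g i j + 1) := by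
    refine le_of_mul_le_mul_left ?_ hrpos
    linarith
  linarith

end Gain

end GridOrientation

/-! ### The recursion for the expected number of steps. -/

open Classical in
/-- The expected number of steps of the directed random walk along a terminating relation. -/
theorem exists_expected_steps {V : Type*} [Fintype V] {R : V → V → Prop}
    (hR : WellFounded fun u v => R v u) :
    ∃ E : V → ℝ, (∀ u, 0 ≤ E u) ∧ ∀ u, E u = if ∃ w, R u w then
      1 + (∑ w with R u w, E w) / ((Finset.univ.filter (R u)).card : ℝ) else 0 := by
  let F : ∀ u, (∀ w, R u w → ℝ) → ℝ := fun u f => if ∃ w, R u w then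
    1 + (∑ w, if h : R u w then f w h else 0) / ((Finset.univ.filter (R u)).card : ℝ) else 0
  have hE : ∀ u, hR.fix F u = if ∃ w, R u w then
      1 + (∑ w with R u w, hR.fix F w) / ((Finset.univ.filter (R u)).card : ℝ) else 0 := by
    intro u
    rw [hR.fix_eq]
    simp only [F, Finset.sum_filter, dite_eq_ite]
  refine ⟨hR.fix F, fun u => ?_, hE⟩
  induction u using hR.induction with
  | _ u ih =>
  rw [hE u]
  split_ifs with h
  · have : 0 ≤ ∑ w with R u w, hR.fix F w :=
      Finset.sum_nonneg fun w hw => ih w (Finset.mem_filter.1 hw).2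
    exact add_nonneg zero_le_one (div_nonneg this (Nat.cast_nonneg _))
  · exact le_rfl

/-! ### Iterating over dyadic scales. -/

namespace GridOrientation

open Classical Finset

variable {α β : Type*} {G : GridOrientation α β}

theorem reflTransGen_swap {i₀ i : α} {j₀ j : β} :
    Relation.ReflTransGen G.swap.Step (j₀, i₀) (j, i) ↔
      Relation.ReflTransGen G.Step (i₀, j₀) (i, j) :=
  ⟨fun h => h.lift Prod.swap fun _ _ h1 => h1.swap, fun h => h.lift Prod.swap fun _ _ h1 => h1.swap⟩

variable [Fintype α] [Fintype β]

theorem IsUSO.sum_step (h : G.IsUSO) (f : α × β → ℝ) (i : α) (j : β) :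
    ∑ w with G.Step (i, j) w, f w = ∑ x ∈ G.outL i j, f (x, j) + ∑ y ∈ G.outR i j, f (i, y) := by
  have e1 : ∑ x ∈ G.outL i j, f (x, j) = ∑ p ∈ (G.outL i j).map
      ⟨fun x => (x, j), fun _ _ hx => (Prod.ext_iff.1 hx).1⟩, f p := by
    rw [Finset.sum_map]; rfl
  have e2 : ∑ y ∈ G.outR i j, f (i, y) = ∑ p ∈ (G.outR i j).map
      ⟨fun y => (i, y), fun _ _ hy => (Prod.ext_iff.1 hy).2⟩, f p := by
    rw [Finset.sum_map]; rfl
  rw [e1, e2, ← Finset.sum_union]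
  · refine Finset.sum_congr ?_ fun _ _ => rfl
    ext ⟨x, y⟩
    rw [Finset.mem_filter, Finset.mem_union, Finset.mem_map, Finset.mem_map]
    constructor
    · rintro ⟨-, ⟨h1, h2⟩ | ⟨h1, h2⟩⟩
      · exact Or.inl ⟨x, mem_outL.2 h2, Prod.ext rfl h1⟩
      · exact Or.inr ⟨y, mem_outR.2 h2, Prod.ext h1 rfl⟩
    · rintro (⟨x', h1, h2⟩ | ⟨y', h1, h2⟩)
      · rw [← h2]
        exact ⟨Finset.mem_univ _, .of_col (mem_outL.1 h1)⟩
      · rw [← h2]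
        exact ⟨Finset.mem_univ _, .of_row (mem_outR.1 h1)⟩
  · rw [Finset.disjoint_left]
    intro p hp hp'
    obtain ⟨x, hx, rfl⟩ := Finset.mem_map.1 hp
    obtain ⟨y, hy, he⟩ := Finset.mem_map.1 hp'
    have hi : i = x := (Prod.ext_iff.1 he).1
    subst hi
    exact h.col_irrefl _ _ (mem_outL.1 hx)

theorem IsUSO.card_step (h : G.IsUSO) (i : α) (j : β) :
    #{w | G.Step (i, j) w} = #(G.outL i j) + #(G.outR i j) := by
  have := h.sum_step (fun _ => 1) i j
  simp only [Finset.sum_const, nsmul_eq_mul, mul_one] at this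
  exact_mod_cast this

theorem Gain.le_sixteen_mul {g : α → β → ℝ} {H η : ℝ} {m : ℕ} {i₀ : α} {j₀ : β} (h : G.IsUSO)
    (hg : G.Gain (fun i j => Relation.ReflTransGen G.Step (i₀, j₀) (i, j)) g H m) (hm : 0 < m)
    (hα : (harmonic (Fintype.card α) : ℝ) ≤ η) (hβ : (harmonic (Fintype.card β) : ℝ) ≤ η)
    (hη : 1 ≤ η) (hl : #(G.outL i₀ j₀) ≤ 2 * m) (hr : #(G.outR i₀ j₀) ≤ 2 * m) {i : α} {j : β}
    (hΦ : Relation.ReflTransGen G.Step (i₀, j₀) (i, j)) :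
    H / 4608 - 2 * η ≤ 16 * (g i j + 2 * η) := by
  rcases le_total #(G.outL i j) #(G.outR i j) with hle | hle
  · exact hg.le_of_card_le h hm hα hβ hη hl hr hΦ hle
  · have hg' := hg.swap
    simp only [← reflTransGen_swap (G := G)] at hg'
    exact hg'.le_of_card_le h.swap hm hβ hα hη hr hl (reflTransGen_swap.2 hΦ) hle

/-- Passing from scale `m` to scale `2 * m` costs only a constant multiple of `η`. This is obtained
by applying the uniform lower bound for the gain at a point where the gain is zero. -/
theorem IsUSO.expected_le_of_lt_two_mul (h : G.IsUSO) {E : α × β → ℝ} {F η : ℝ} {m : ℕ}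
    (hE : ∀ i j, (#(G.outL i j) + #(G.outR i j)) * E (i, j) = #(G.outL i j) + #(G.outR i j) +
      (∑ x ∈ G.outL i j, E (x, j) + ∑ y ∈ G.outR i j, E (i, y)))
    (hm : 0 < m) (hα : (harmonic (Fintype.card α) : ℝ) ≤ η)
    (hβ : (harmonic (Fintype.card β) : ℝ) ≤ η) (hη : 1 ≤ η)
    (hF : ∀ i j, #(G.outL i j) < m → #(G.outR i j) < m → E (i, j) ≤ F) {i₀ : α} {j₀ : β}
    (hl : #(G.outL i₀ j₀) < 2 * m) (hr : #(G.outR i₀ j₀) < 2 * m) :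
    E (i₀, j₀) ≤ F + 156672 * η := by
  -- Maximizing over the vertices reachable from `(i₀, j₀)` makes the gain nonnegative on a set
  -- closed under steps.
  obtain ⟨⟨i₁, j₁⟩, hmem, hmax⟩ := Finset.exists_max_image
    {u | Relation.ReflTransGen G.Step (i₀, j₀) u} E ⟨(i₀, j₀), by simp [Relation.ReflTransGen.refl]⟩
  simp only [Finset.mem_filter, Finset.mem_univ, true_and] at hmem hmax
  refine (hmax _ .refl).trans ?_
  rcases le_or_gt (E (i₁, j₁)) F with hle | hlt
  · linarith
  set H := E (i₁, j₁) - F with hH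
  have hH0 : 0 < H := by linarith
  -- The truncation at `H` makes the gain equal to `H` at the small scale even where `E` is below
  -- `F`; a minimum with a constant preserves the averaging inequality.
  let g : α → β → ℝ := fun i j => min (H - (E (i, j) - F)) H
  have hg : G.Gain (fun i j => Relation.ReflTransGen G.Step (i₀, j₀) (i, j)) g H m := by
    refine ⟨fun h1 h2 => h1.tail (.of_col h2), fun h1 h2 => h1.tail (.of_row h2), fun h1 => ?_,
      fun _ => min_le_right _ _, fun _ h2 h3 => ?_, fun {i j} h1 h2 => ?_⟩
    · exact le_min (by have := hmax _ h1; linarith) hH0.le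
    · exact min_eq_right (by have := hF _ _ h2 h3; linarith)
    · have e := hE i j
      have hpos : (0 : ℝ) ≤ #(G.outL i j) + #(G.outR i j) := by positivity
      have a1 : ∑ x ∈ G.outL i j, g x j ≤ ∑ x ∈ G.outL i j, (H + F - E (x, j)) :=
        Finset.sum_le_sum fun x _ => (min_le_left _ _).trans (by linarith)
      have a2 : ∑ y ∈ G.outR i j, g i y ≤ ∑ y ∈ G.outR i j, (H + F - E (i, y)) :=
        Finset.sum_le_sum fun y _ => (min_le_left _ _).trans (by linarith)
      have b1 : ∑ x ∈ G.outL i j, g x j ≤ ∑ x ∈ G.outL i j, H :=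
        Finset.sum_le_sum fun x _ => min_le_right _ _
      have b2 : ∑ y ∈ G.outR i j, g i y ≤ ∑ y ∈ G.outR i j, H :=
        Finset.sum_le_sum fun y _ => min_le_right _ _
      rw [Finset.sum_sub_distrib] at a1 a2
      simp only [Finset.sum_const, nsmul_eq_mul] at a1 a2 b1 b2
      rcases le_total (H - (E (i, j) - F)) H with hc | hc
      · simp only [g, min_eq_left hc] at *
        linarith
      · simp only [g, min_eq_right hc] at *
        linarith
  have := hg.le_sixteen_mul h hm hα hβ hη hl.le hr.le hmem
  -- The lower bound becomes `H / 4608 - 2 * η ≤ 32 * η`, and `156672 = 4608 * 34`.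
  have hg0 : g i₁ j₁ = 0 := by simp [g, hH, hlt.le]
  rw [hg0] at this
  linarith

/-- The directed random walk on a grid with a unique sink orientation has an expected number of
steps that is polylogarithmic in the size of the grid. -/
theorem IsUSO.expected_le (h : G.IsUSO) {E : α × β → ℝ} {n : ℕ}
    (hE : ∀ u, E u = if ∃ w, G.Step u w then
      1 + (∑ w with G.Step u w, E w) / (#{w | G.Step u w} : ℝ) else 0)
    (hα : Fintype.card α ≤ n) (hβ : Fintype.card β ≤ n) (u : α × β) :
    E u ≤ (Nat.log 2 n + 1) * (156672 * (1 + Real.log n)) := by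
  have hE' : ∀ i j, ((#(G.outL i j) : ℝ) + #(G.outR i j)) * E (i, j) = #(G.outL i j) + #(G.outR i j) +
      (∑ x ∈ G.outL i j, E (x, j) + ∑ y ∈ G.outR i j, E (i, y)) := by
    intro i j
    rw [← h.sum_step, ← Nat.cast_add, ← h.card_step, hE (i, j)]
    split_ifs with hw
    · have : (#{w | G.Step (i, j) w} : ℝ) ≠ 0 := by
        obtain ⟨w, hw⟩ := hw
        exact_mod_cast (Finset.card_pos.2 ⟨w, by simpa using hw⟩).ne'
      rw [mul_add, mul_div_cancel₀ _ this, mul_one]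
    · push Not at hw
      simp [hw]
  have hη : 1 ≤ 1 + Real.log n := by
    have := Real.log_natCast_nonneg n
    linarith
  have hη1 : (harmonic n : ℝ) ≤ 1 + Real.log n := harmonic_le_one_add_log n
  -- At `t = 0` both out-degrees vanish and the vertex is the global sink.
  have key : ∀ t : ℕ, ∀ i j, #(G.outL i j) < 2 ^ t → #(G.outR i j) < 2 ^ t →
      E (i, j) ≤ t * (156672 * (1 + Real.log n)) := by
    intro t
    induction t with
    | zero =>
      intro i j h1 h2
      rw [hE, if_neg]
      · simp
      · rintro ⟨w, hw⟩
        have h3 := h.card_step i j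
        have h4 : 0 < #{w | G.Step (i, j) w} := Finset.card_pos.2 ⟨w, by simpa using hw⟩
        omega
    | succ t ih =>
      intro i j h1 h2
      have := h.expected_le_of_lt_two_mul hE' (m := 2 ^ t) (by positivity)
        ((harmonic_cast_mono hα).trans hη1) ((harmonic_cast_mono hβ).trans hη1) hη ih
        (i₀ := i) (j₀ := j) (by rw [pow_succ] at h1; omega) (by rw [pow_succ] at h2; omega)
      push_cast
      linarith
  have hlog := Nat.lt_pow_succ_log_self (b := 2) (by norm_num) n
  have := key (Nat.log 2 n + 1) u.1 u.2
    (((Finset.card_le_univ _).trans hα).trans_lt hlog)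
    (((Finset.card_le_univ _).trans hβ).trans_lt hlog)
  push_cast at this
  exact this

end GridOrientation

/-! ### From the recursion to the random process. -/

namespace DirectedWalk

open Classical Finset

variable {V : Type*} {R : V → V → Prop}

/-- All times before the first visit to a sink are counted by the series, which is infinite if no
sink is ever visited. -/
theorem stepsToSink_le_tsum (x : ℕ → V) :
    stepsToSink R x ≤ ∑' k, if IsSink R (x k) then 0 else 1 := by
  by_cases h : ∃ k, IsSink R (x k)
  · refine (iInf₂_le (Nat.find h) (Nat.find_spec h)).trans ?_
    calc ((Nat.find h : ℕ) : ℝ≥0∞) = ∑ k ∈ Finset.range (Nat.find h),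
          if IsSink R (x k) then (0 : ℝ≥0∞) else 1 := by
          rw [Finset.sum_congr rfl fun k hk =>
            if_neg (Nat.find_min h (Finset.mem_range.1 hk))]
          simp
      _ ≤ _ := ENNReal.sum_le_tsum _
  · push Not at h
    simp [h]

variable {Ω : Type*} [MeasurableSpace Ω] {μ : Measure Ω} {v₀ : V} {X : ℕ → Ω → V}

theorem IsDirectedRandomWalk.measurableSet_prefix (hX : IsDirectedRandomWalk μ R v₀ X) (k : ℕ) (y : Fin (k + 1) → V) :
    MeasurableSet {ω | ∀ i : Fin (k + 1), X i ω = y i} := by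
  rw [Set.ofPred_forall]
  exact MeasurableSet.iInter fun i => hX.measurableSet_eq _ _

variable [Fintype V]

theorem sum_stepProb_mul {E : V → ℝ} (hE0 : ∀ u, 0 ≤ E u) (hE : ∀ u, E u = if ∃ w, R u w then
      1 + (∑ w with R u w, E w) / (#{w | R u w} : ℝ) else 0) (u : V) :
    (if IsSink R u then 0 else 1) + ∑ v, stepProb R u v * ENNReal.ofReal (E v) =
      ENNReal.ofReal (E u) := by
  by_cases hs : IsSink R u
  · simp [stepProb, hs]
  · have hex : ∃ w, R u w := by simpa [IsSink] using hs
    have hcard : {w | R u w}.ncard = #{w | R u w} := by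
      rw [← Set.ncard_coe_finset]
      simp
    have hpos : (0 : ℝ) < #{w | R u w} := by
      obtain ⟨w, hw⟩ := hex
      exact_mod_cast Finset.card_pos.2 ⟨w, by simpa using hw⟩
    have hsum : ∑ v, stepProb R u v * ENNReal.ofReal (E v) =
        ENNReal.ofReal ((∑ w with R u w, E w) / (#{w | R u w} : ℝ)) := by
      rw [ENNReal.ofReal_div_of_pos hpos, ENNReal.ofReal_sum_of_nonneg fun w _ => hE0 w,
        ENNReal.ofReal_natCast, div_eq_mul_inv, Finset.sum_mul, Finset.sum_filter]
      refine Finset.sum_congr rfl fun v _ => ?_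
      simp only [stepProb, if_neg hs, hcard]
      split_ifs
      · rw [mul_comm]
      · simp
    rw [if_neg hs, hsum, hE u, if_pos hex, ENNReal.ofReal_add zero_le_one, ENNReal.ofReal_one]
    exact div_nonneg (Finset.sum_nonneg fun w _ => hE0 w) hpos.le

namespace IsDirectedRandomWalk

theorem measure_eq_sum_inter (hX : IsDirectedRandomWalk μ R v₀ X) (k : ℕ) {B : Set Ω}
    (hB : MeasurableSet B) :
    μ B = ∑ y : Fin (k + 1) → V, μ ({ω | ∀ i : Fin (k + 1), X i ω = y i} ∩ B) := by
  rw [← measure_biUnion_finset]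
  · congr 1
    ext ω
    simp only [Set.mem_iUnion, Finset.mem_univ, exists_true_left, Set.mem_inter_iff,
      Set.mem_ofPred_eq]
    exact ⟨fun h => ⟨fun i => X i ω, fun _ => rfl, h⟩, fun ⟨_, _, h⟩ => h⟩
  · intro y _ y' _ hne
    refine Set.disjoint_left.2 fun ω h1 h2 => hne ?_
    ext i
    rw [← h1.1 i, h2.1 i]
  · exact fun y _ => (hX.measurableSet_prefix k y).inter hB

/-- The law of the walk is given only on full histories, so the one-step equation follows by summing
over all prefixes of length `k + 1` and grouping them by their last vertex. -/
theorem measure_succ (hX : IsDirectedRandomWalk μ R v₀ X) (k : ℕ) (v : V) :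
    μ {ω | X (k + 1) ω = v} = ∑ u, μ {ω | X k ω = u} * stepProb R u v := by
  have h1 : ∀ y : Fin (k + 1) → V,
      μ ({ω | ∀ i : Fin (k + 1), X i ω = y i} ∩ {ω | X (k + 1) ω = v}) =
        μ {ω | ∀ i : Fin (k + 1), X i ω = y i} * stepProb R (y (Fin.last k)) v := by
    intro y
    have := hX.step k fun i => if h : i < k + 1 then y ⟨i, h⟩ else v
    simp only [lt_add_iff_pos_right, zero_lt_one, dite_true, lt_self_iff_false, dite_false] at this
    have hlast : y ⟨k, by omega⟩ = y (Fin.last k) := rfl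
    rw [hlast] at this
    convert this using 2
    · ext ω
      simp only [Set.mem_inter_iff, Set.mem_ofPred_eq]
      constructor
      · rintro ⟨h1, h2⟩ i hi
        split_ifs with hlt
        · exact h1 ⟨i, hlt⟩
        · rw [show i = k + 1 by omega, h2]
      · intro h1
        refine ⟨fun i => ?_, ?_⟩
        · have := h1 i (by omega)
          simpa [i.2] using this
        · simpa using h1 (k + 1) le_rfl
    · congr 1
      ext ω
      simp only [Set.mem_ofPred_eq]
      constructor
      · intro h1 i hi
        rw [dif_pos (by omega)]
        exact h1 ⟨i, by omega⟩
      · intro h1 i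
        have := h1 i (by omega)
        simpa [i.2] using this
  have h2 : ∀ u, μ {ω | X k ω = u} = ∑ y : Fin (k + 1) → V,
      if y (Fin.last k) = u then μ {ω | ∀ i : Fin (k + 1), X i ω = y i} else 0 := by
    intro u
    rw [hX.measure_eq_sum_inter k (hX.measurableSet_eq k u)]
    refine Finset.sum_congr rfl fun y _ => ?_
    split_ifs with hy
    · congr 1
      refine Set.inter_eq_left.2 fun ω hω => ?_
      rw [← hy]
      exact hω (Fin.last k)
    · rw [← measure_empty (μ := μ)]
      congr 1
      refine Set.disjoint_iff_inter_eq_empty.1 (Set.disjoint_left.2 fun ω h3 h4 => hy ?_)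
      rw [← h3 (Fin.last k)]
      exact h4
  rw [hX.measure_eq_sum_inter k (hX.measurableSet_eq (k + 1) v)]
  simp only [h1, h2, Finset.sum_mul]
  rw [Finset.sum_comm]
  refine Finset.sum_congr rfl fun y _ => ?_
  simp [ite_mul]

theorem measurableSet_not_isSink (hX : IsDirectedRandomWalk μ R v₀ X) (k : ℕ) :
    MeasurableSet {ω | ¬ IsSink R (X k ω)} := by
  have : {ω | ¬ IsSink R (X k ω)} = ⋃ u ∈ {u | ¬ IsSink R u}, {ω | X k ω = u} := by
    ext ω
    simp
  rw [this]
  exact MeasurableSet.biUnion (Set.to_countable _) fun u _ => hX.measurableSet_eq k u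

theorem measure_not_isSink (hX : IsDirectedRandomWalk μ R v₀ X) (k : ℕ) :
    μ {ω | ¬ IsSink R (X k ω)} = ∑ u, μ {ω | X k ω = u} * if IsSink R u then 0 else 1 := by
  have : {ω | ¬ IsSink R (X k ω)} = ⋃ u ∈ Finset.univ.filter (fun u => ¬ IsSink R u),
      {ω | X k ω = u} := by
    ext ω
    simp
  rw [this, measure_biUnion_finset]
  · rw [Finset.sum_filter]
    refine Finset.sum_congr rfl fun u _ => ?_
    split_ifs <;> simp_all
  · intro u _ v _ hne
    refine Set.disjoint_left.2 fun ω h1 h2 => hne ?_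
    rw [← h1, ← h2]
  · exact fun u _ => hX.measurableSet_eq k u

/-- The expected time spent outside sinks before time `K`, plus the expectation of `E` at time `K`,
does not depend on `K`. Dropping the second term and letting `K` grow gives the bound. -/
theorem lintegral_stepsToSink_le [IsProbabilityMeasure μ] (hX : IsDirectedRandomWalk μ R v₀ X)
    {E : V → ℝ} (hE0 : ∀ u, 0 ≤ E u) (hE : ∀ u, E u = if ∃ w, R u w then
      1 + (∑ w with R u w, E w) / (#{w | R u w} : ℝ) else 0) :
    ∫⁻ ω, stepsToSink R (fun k => X k ω) ∂μ ≤ ENNReal.ofReal (E v₀) := by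
  have hstep : ∀ k, μ {ω | ¬ IsSink R (X k ω)} +
      ∑ v, μ {ω | X (k + 1) ω = v} * ENNReal.ofReal (E v) =
        ∑ v, μ {ω | X k ω = v} * ENNReal.ofReal (E v) := by
    intro k
    rw [hX.measure_not_isSink]
    simp only [hX.measure_succ, Finset.sum_mul]
    rw [Finset.sum_comm, ← Finset.sum_add_distrib]
    refine Finset.sum_congr rfl fun u _ => ?_
    rw [← sum_stepProb_mul hE0 hE u, mul_add, Finset.mul_sum]
    simp only [mul_assoc]
  have hstart : ∑ v, μ {ω | X 0 ω = v} * ENNReal.ofReal (E v) = ENNReal.ofReal (E v₀) := by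
    rw [Finset.sum_eq_single v₀]
    · have : μ {ω | X 0 ω = v₀} = 1 := (prob_compl_eq_zero_iff (hX.measurableSet_eq 0 v₀)).1 hX.start
      rw [this, one_mul]
    · intro v _ hv
      have : μ {ω | X 0 ω = v} = 0 := measure_mono_null (fun ω hω => by
        simp only [Set.mem_ofPred_eq] at hω
        simpa [hω] using hv) hX.start
      rw [this, zero_mul]
    · simp
  have hsum : ∀ K, ∑ k ∈ Finset.range K, μ {ω | ¬ IsSink R (X k ω)} +
      ∑ v, μ {ω | X K ω = v} * ENNReal.ofReal (E v) = ENNReal.ofReal (E v₀) := by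
    intro K
    induction K with
    | zero => simpa using hstart
    | succ K ih => rw [Finset.sum_range_succ, add_assoc, hstep, ih]
  calc ∫⁻ ω, stepsToSink R (fun k => X k ω) ∂μ
      ≤ ∫⁻ ω, ∑' k, (if IsSink R (X k ω) then 0 else 1) ∂μ :=
        lintegral_mono fun ω => stepsToSink_le_tsum _
    _ = ∑' k, ∫⁻ ω, (if IsSink R (X k ω) then 0 else 1) ∂μ := by
        refine lintegral_tsum fun k => (Measurable.ite ?_ measurable_const measurable_const).aemeasurable
        rw [← MeasurableSet.compl_iff]
        exact hX.measurableSet_not_isSink k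
    _ = ∑' k, μ {ω | ¬ IsSink R (X k ω)} := by
        refine tsum_congr fun k => ?_
        rw [← lintegral_indicator_one (hX.measurableSet_not_isSink k)]
        refine lintegral_congr fun ω => ?_
        by_cases hs : IsSink R (X k ω) <;> simp [hs]
    _ ≤ ENNReal.ofReal (E v₀) := ENNReal.tsum_le_of_sum_range_le fun K => by
        rw [← hsum K]
        exact le_self_add

end IsDirectedRandomWalk

end DirectedWalk

/-! ### Irredundant descriptions and facets of polytopes. -/

namespace Polytope

open Finset Classical Topology

variable {E : Type*} [NormedAddCommGroup E] [NormedSpace ℝ E]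

/-- An irredundant description of `P` by linear inequalities inside its affine hull, together
with a point that satisfies all of them strictly. -/
structure Description {ι : Type*} (P : Set E) (a : ι → StrongDual ℝ E) (b : ι → ℝ) (z : E) : Prop where
  mem_iff : ∀ x, x ∈ P ↔ x - z ∈ vectorSpan ℝ P ∧ ∀ i, a i x ≤ b i
  lt : ∀ i, a i z < b i
  irredundant : ∀ i, ∃ y, y - z ∈ vectorSpan ℝ P ∧ b i < a i y ∧ ∀ j ≠ i, a j y ≤ b j

theorem eq_zero_of_mem_vectorSpan {P : Set E} {l : StrongDual ℝ E} {c : ℝ} (h : ∀ x ∈ P, l x = c)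
    {v : E} (hv : v ∈ vectorSpan ℝ P) : l v = 0 := by
  have : vectorSpan ℝ P ≤ LinearMap.ker (l : E →ₗ[ℝ] ℝ) := by
    rw [vectorSpan_def, Submodule.span_le]
    rintro _ ⟨x, hx, y, hy, rfl⟩
    simp [h x hx, h y hy]
  simpa using this hv

/-- A subfamily of least cardinality that still cuts out `P` in its affine hull is irredundant. An
inequality tight on all of `P` would be constant on the affine hull and could have no violator
there, so each is strict somewhere; averaging produces one point strict for all. -/
theorem exists_description {P : Set E} (hP : IsPolytope P) (hne : P.Nonempty) :
    ∃ (k : ℕ) (I : Finset (Fin k)) (a : I → StrongDual ℝ E) (b : I → ℝ) (z : E),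
      Description P a b z := by
  obtain ⟨-, k, a, b, hab⟩ := hP
  obtain ⟨x₀, hx₀⟩ := hne
  have hbase : ∀ x, x ∈ P ↔ x - x₀ ∈ vectorSpan ℝ P ∧ ∀ i ∈ (Finset.univ : Finset (Fin k)),
      a i x ≤ b i := fun x => by
    refine ⟨fun hx => ⟨vsub_mem_vectorSpan ℝ hx hx₀, fun i _ => ?_⟩, fun hx => ?_⟩
    · rw [hab] at hx; exact hx i
    · rw [hab]; exact fun i => hx.2 i (Finset.mem_univ i)
  obtain ⟨I, hI, hmin⟩ := Finset.exists_min_image (Finset.univ.filter fun I : Finset (Fin k) =>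
    ∀ x, x ∈ P ↔ x - x₀ ∈ vectorSpan ℝ P ∧ ∀ i ∈ I, a i x ≤ b i) Finset.card
    ⟨Finset.univ, by simpa using hbase⟩
  simp only [Finset.mem_filter, Finset.mem_univ, true_and] at hI hmin
  have hirr : ∀ i ∈ I, ∃ y, y - x₀ ∈ vectorSpan ℝ P ∧ b i < a i y ∧
      ∀ j ∈ I, j ≠ i → a j y ≤ b j := by
    intro i hi
    by_contra hcon
    push Not at hcon
    refine absurd (hmin (I.erase i) fun x => ?_) (not_le.2 (Finset.card_erase_lt_of_mem hi))
    rw [hI]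
    refine and_congr_right fun hx => ⟨fun h j hj => h j (Finset.mem_of_mem_erase hj), fun h => ?_⟩
    by_contra hcon'
    push Not at hcon'
    obtain ⟨j, hj, hlt⟩ := hcon'
    have hji : j = i := by
      by_contra hji
      exact absurd (h j (Finset.mem_erase.2 ⟨hji, hj⟩)) (not_le.2 hlt)
    subst hji
    obtain ⟨l, hl, hlj, hl'⟩ := hcon x hx hlt
    exact absurd (h l (Finset.mem_erase.2 ⟨hlj, hl⟩)) (not_le.2 hl')
  have hle : ∀ x ∈ P, ∀ i ∈ I, a i x ≤ b i := fun x hx => ((hI x).1 hx).2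
  have hstrict : ∀ i ∈ I, ∃ x ∈ P, a i x < b i := by
    intro i hi
    by_contra hcon
    push Not at hcon
    obtain ⟨y, hy, hlt, -⟩ := hirr i hi
    have h1 := eq_zero_of_mem_vectorSpan (l := a i) (c := b i)
      (fun x hx => le_antisymm (hle x hx i hi) (hcon x hx)) hy
    rw [map_sub] at h1
    have := hle x₀ hx₀ i hi
    linarith
  have hmid : ∀ x ∈ P, ∀ y ∈ P, (1 / 2 : ℝ) • x + (1 / 2 : ℝ) • y ∈ P := by
    intro x hx y hy
    rw [hab] at hx hy ⊢
    intro i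
    have h1 := hx i
    have h2 := hy i
    simp only [map_add, map_smul, smul_eq_mul]
    linarith
  have hz : ∀ J ⊆ I, ∃ z ∈ P, ∀ i ∈ J, a i z < b i := by
    intro J
    induction J using Finset.induction_on with
    | empty => exact fun _ => ⟨x₀, hx₀, by simp⟩
    | insert i J _ ih =>
      intro hJ
      obtain ⟨z, hz, hlt⟩ := ih ((Finset.subset_insert _ _).trans hJ)
      obtain ⟨x, hx, hlt'⟩ := hstrict i (hJ (Finset.mem_insert_self _ _))
      refine ⟨_, hmid z hz x hx, fun j hj => ?_⟩
      simp only [map_add, map_smul, smul_eq_mul]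
      rcases Finset.mem_insert.1 hj with rfl | hj'
      · have := hle z hz j (hJ hj)
        linarith
      · have := hle x hx j (hJ hj)
        have := hlt j hj'
        linarith
  obtain ⟨z, hz, hlt⟩ := hz I subset_rfl
  have hshift : ∀ x, x - z ∈ vectorSpan ℝ P ↔ x - x₀ ∈ vectorSpan ℝ P := fun x => by
    have h1 : z - x₀ ∈ vectorSpan ℝ P := vsub_mem_vectorSpan ℝ hz hx₀
    rw [show x - x₀ = (x - z) + (z - x₀) by abel, Submodule.add_mem_iff_left _ h1]
  refine ⟨k, I, fun i => a i, fun i => b i, z, fun x => ?_, fun i => hlt i i.2, fun i => ?_⟩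
  · rw [hshift, hI]
    simp
  · obtain ⟨y, h1, h2, h3⟩ := hirr i i.2
    exact ⟨y, (hshift y).2 h1, h2, fun j hj => h3 j j.2 fun h => hj (Subtype.ext h)⟩

namespace Description

variable {ι : Type*} {P : Set E} {a : ι → StrongDual ℝ E} {b : ι → ℝ} {z : E}

theorem base_mem (h : Description P a b z) : z ∈ P :=
  (h.mem_iff z).2 ⟨by simp, fun i => (h.lt i).le⟩

theorem le (h : Description P a b z) {x : E} (hx : x ∈ P) (i : ι) : a i x ≤ b i :=
  ((h.mem_iff x).1 hx).2 i

theorem add_mem_iff (h : Description P a b z) {x v : E} (hx : x ∈ P) (hv : v ∈ vectorSpan ℝ P) :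
    x + v ∈ P ↔ ∀ i, a i x + a i v ≤ b i := by
  rw [h.mem_iff]
  simp only [map_add, and_iff_right_iff_imp]
  intro _
  rw [add_sub_right_comm]
  exact Submodule.add_mem _ ((h.mem_iff x).1 hx).1 hv

theorem exists_pos_of_lt [Finite ι] (x v : E) :
    ∃ ε : ℝ, 0 < ε ∧ ∀ i, a i x < b i → a i x + ε * a i v < b i := by
  have : ∀ᶠ ε in 𝓝[>] (0 : ℝ), ∀ i, a i x < b i → a i x + ε * a i v < b i := by
    refine Filter.eventually_all.2 fun i => ?_
    by_cases hi : a i x < b i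
    · have hc : Filter.Tendsto (fun ε : ℝ => a i x + ε * a i v) (𝓝 0) (𝓝 (a i x + 0 * a i v)) :=
        Continuous.tendsto (by fun_prop) 0
      rw [zero_mul, add_zero] at hc
      filter_upwards [(hc.mono_left nhdsWithin_le_nhds).eventually_lt_const hi] with ε hε _ using hε
    · exact Filter.Eventually.of_forall fun _ h => absurd h hi
  obtain ⟨ε, h1, h2⟩ := (this.and self_mem_nhdsWithin).exists
  exact ⟨ε, h2, h1⟩

/-- The facet on which the inequality `i` is tight. -/
def facet (P : Set E) (a : ι → StrongDual ℝ E) (b : ι → ℝ) (i : ι) : Set E := {x ∈ P | a i x = b i}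

/-- On the way from `z` to the violator of inequality `i`, the other inequalities remain strict up
to the point where `i` becomes tight. -/
theorem exists_facet_point (h : Description P a b z) (i : ι) :
    ∃ x ∈ P, a i x = b i ∧ ∀ j ≠ i, a j x < b j := by
  obtain ⟨y, hy, hlt, hle⟩ := h.irredundant i
  have hz := h.lt i
  set t : ℝ := (b i - a i z) / (a i y - a i z) with ht
  have hpos : 0 < a i y - a i z := by linarith
  have ht0 : 0 < t := div_pos (by linarith) hpos
  have ht1 : t < 1 := (div_lt_one hpos).2 (by linarith)
  have hti : t * (a i y - a i z) = b i - a i z := div_mul_cancel₀ _ hpos.ne'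
  have hval : ∀ j, a j (t • (y - z)) = t * (a j y - a j z) := fun j => by
    simp
  have hj : ∀ j ≠ i, a j z + a j (t • (y - z)) < b j := fun j hj => by
    rw [hval]
    have := hle j hj
    have := h.lt j
    nlinarith
  refine ⟨z + t • (y - z), (h.add_mem_iff h.base_mem (Submodule.smul_mem _ _ hy)).2 fun j => ?_,
    ?_, fun j hji => ?_⟩
  · rcases eq_or_ne j i with rfl | hji
    · rw [hval, hti]; linarith
    · exact (hj j hji).le
  · rw [map_add, hval, hti]; ring
  · rw [map_add]; exact hj j hji

theorem facet_injective (h : Description P a b z) : Function.Injective (facet P a b) := by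
  intro i j hij
  obtain ⟨x, hx, hxi, hlt⟩ := h.exists_facet_point i
  by_contra hne
  have : x ∈ facet P a b j := hij ▸ ⟨hx, hxi⟩
  exact absurd this.2 (hlt j (Ne.symm hne)).ne

/-- The sum of the functionals in `K` attains its upper bound exactly where all of them are tight.
-/
theorem isFace_of_finset (h : Description P a b z) (K : Finset ι)
    (hne : {x ∈ P | ∀ i ∈ K, a i x = b i}.Nonempty) : IsFace P {x ∈ P | ∀ i ∈ K, a i x = b i} := by
  refine ⟨hne, fun _ => ⟨∑ i ∈ K, a i, ?_⟩⟩
  obtain ⟨x₁, hx₁, hK⟩ := hne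
  ext x
  simp only [Set.mem_ofPred_eq, _root_.sum_apply]
  refine and_congr_right fun hx => ⟨fun hxK y hy => ?_, fun hmax => ?_⟩
  · exact Finset.sum_le_sum fun i hi => (h.le hy i).trans (hxK i hi).ge
  · have h1 := hmax x₁ hx₁
    rw [Finset.sum_congr rfl hK] at h1
    have h2 := (Finset.sum_eq_sum_iff_of_le fun i _ => h.le hx i).1
      (le_antisymm (Finset.sum_le_sum fun i _ => h.le hx i) h1)
    exact h2

theorem isFace_facet (h : Description P a b z) (i : ι) : IsFace P (facet P a b i) := by
  obtain ⟨x, hx, hxi, -⟩ := h.exists_facet_point i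
  have := h.isFace_of_finset {i} ⟨x, by simpa using ⟨hx, hxi⟩⟩
  simpa [facet] using this

theorem vectorSpan_facet [Finite ι] (h : Description P a b z) (i : ι) :
    vectorSpan ℝ (facet P a b i) = vectorSpan ℝ P ⊓ LinearMap.ker (a i : E →ₗ[ℝ] ℝ) := by
  refine le_antisymm (le_inf (vectorSpan_mono ℝ fun x hx => hx.1) fun v hv => ?_) ?_
  · exact eq_zero_of_mem_vectorSpan (l := a i) (fun x hx => hx.2) hv
  · rintro v ⟨hv, hker⟩
    have hker' : a i v = 0 := hker
    obtain ⟨x, hx, hxi, hlt⟩ := h.exists_facet_point i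
    obtain ⟨ε, hε, hle⟩ := exists_pos_of_lt (a := a) (b := b) x v
    have hmem : x + ε • v ∈ facet P a b i := by
      refine ⟨(h.add_mem_iff hx (Submodule.smul_mem _ _ hv)).2 fun j => ?_, by simp [hker', hxi]⟩
      rw [map_smul, smul_eq_mul]
      rcases eq_or_ne j i with rfl | hji
      · rw [hker', hxi]; simp
      · exact (hle j (hlt j hji)).le
    have := vsub_mem_vectorSpan ℝ hmem (⟨hx, hxi⟩ : x ∈ facet P a b i)
    rw [vsub_eq_sub, add_sub_cancel_left] at this
    rwa [Submodule.smul_mem_iff _ hε.ne'] at this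

theorem dim_facet [Finite ι] [FiniteDimensional ℝ E] (h : Description P a b z) (i : ι) :
    dim (facet P a b i) + 1 = dim P := by
  rw [dim, dim, h.vectorSpan_facet]
  obtain ⟨y, hy, hlt, -⟩ := h.irredundant i
  set l : vectorSpan ℝ P →ₗ[ℝ] ℝ := (a i : E →ₗ[ℝ] ℝ).domRestrict (vectorSpan ℝ P) with hl
  have hl0 : l ≠ 0 := fun h0 => by
    have h1 : l ⟨y - z, hy⟩ = 0 := by rw [h0]; rfl
    have h2 : a i y - a i z = 0 := by simpa [hl] using h1
    have := h.lt i
    linarith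
  have h1 := Module.Dual.finrank_ker_add_one_of_ne_zero hl0
  rw [← h1]
  congr 1
  rw [hl, LinearMap.ker_domRestrict]
  have : (vectorSpan ℝ P ⊓ LinearMap.ker (a i : E →ₗ[ℝ] ℝ)) =
      ((LinearMap.ker (a i : E →ₗ[ℝ] ℝ)).submoduleOf (vectorSpan ℝ P)).map
        (vectorSpan ℝ P).subtype := by
    rw [Submodule.submoduleOf, Submodule.map_comap_subtype]
  rw [this]
  exact (Submodule.finrank_map_subtype_eq _ _)

theorem isFacet_facet [Finite ι] [FiniteDimensional ℝ E] (h : Description P a b z) (i : ι) :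
    IsFacet P (facet P a b i) := ⟨h.isFace_facet i, h.dim_facet i⟩

theorem convex (h : Description P a b z) : Convex ℝ P := by
  intro x hx y hy s t hs ht hst
  rw [h.mem_iff] at hx hy ⊢
  refine ⟨?_, fun i => ?_⟩
  · have : s • x + t • y - z = s • (x - z) + t • (y - z) := by
      rw [smul_sub, smul_sub, sub_add_sub_comm, ← add_smul, hst, one_smul]
    rw [this]
    exact Submodule.add_mem _ (Submodule.smul_mem _ _ hx.1) (Submodule.smul_mem _ _ hy.1)
  · have h1 := hx.2 i
    have h2 := hy.2 i
    simp only [map_add, map_smul, smul_eq_mul]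
    calc s * a i x + t * a i y ≤ s * b i + t * b i := by gcongr
      _ = b i := by rw [← add_mul, hst, one_mul]

theorem exists_lt_of_forall_exists [Finite ι] (h : Description P a b z) {F : Set E} (hF : F ⊆ P)
    (hconv : Convex ℝ F) (hne : F.Nonempty) (hlt : ∀ i, ∃ x ∈ F, a i x < b i) :
    ∃ x ∈ F, ∀ i, a i x < b i := by
  have := Fintype.ofFinite ι
  suffices ∀ J : Finset ι, ∃ x ∈ F, ∀ i ∈ J, a i x < b i by
    obtain ⟨x, hx, hx'⟩ := this Finset.univ
    exact ⟨x, hx, fun i => hx' i (Finset.mem_univ i)⟩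
  intro J
  induction J using Finset.induction_on with
  | empty =>
    obtain ⟨x, hx⟩ := hne
    exact ⟨x, hx, by simp⟩
  | insert i J _ ih =>
    obtain ⟨x, hx, hxJ⟩ := ih
    obtain ⟨y, hy, hyi⟩ := hlt i
    refine ⟨(1 / 2 : ℝ) • x + (1 / 2 : ℝ) • y,
      hconv hx hy (by norm_num) (by norm_num) (by norm_num), fun j hj => ?_⟩
    simp only [map_add, map_smul, smul_eq_mul]
    rcases Finset.mem_insert.1 hj with rfl | hj'
    · have := h.le (hF hx) j
      linarith
    · have := h.le (hF hy) j
      have := hxJ j hj'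
      linarith

/-- If `F` lay in no set `facet P a b i`, convexity would give a point of `F` strict for all
inequalities; a functional maximal there is constant on `P`, so `F = P`, against the dimension. Once
`F` lies in such a facet, both have the same direction space, on which the exposing functional
vanishes. -/
theorem exists_eq_facet [Finite ι] [FiniteDimensional ℝ E] (h : Description P a b z) {F : Set E}
    (hF : IsFacet P F) : ∃ i, F = facet P a b i := by
  obtain ⟨⟨hne, hexp⟩, hdim⟩ := hF
  have hFP : F ⊆ P := hexp.subset
  obtain ⟨l, hl⟩ := hexp hne
  have hsub : ∃ i, F ⊆ facet P a b i := by
    by_contra hcon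
    push Not at hcon
    obtain ⟨x, hx, hlt⟩ := h.exists_lt_of_forall_exists hFP (hexp.convex h.convex) hne fun i => by
      obtain ⟨x, hx, hx'⟩ := Set.not_subset.1 (hcon i)
      exact ⟨x, hx, lt_of_le_of_ne (h.le (hFP hx) i) fun e => hx' ⟨hFP hx, e⟩⟩
    have hmax : ∀ y ∈ P, l y ≤ l x := by
      rw [hl] at hx; exact hx.2
    have hFeq : P ⊆ F := fun y hy => by
      rw [hl]
      refine ⟨hy, fun w hw => (hmax w hw).trans ?_⟩
      obtain ⟨ε, hε, hle⟩ := exists_pos_of_lt (a := a) (b := b) x (x - y)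
      have hmem : x + ε • (x - y) ∈ P := (h.add_mem_iff (hFP hx) (Submodule.smul_mem _ _
        (vsub_mem_vectorSpan ℝ (hFP hx) hy))).2 fun j => by
          rw [map_smul, smul_eq_mul]
          exact (hle j (hlt j)).le
      have := hmax _ hmem
      simp only [map_add, map_smul, map_sub, smul_eq_mul] at this
      nlinarith
    rw [Set.Subset.antisymm hFP hFeq] at hdim
    omega
  obtain ⟨i, hi⟩ := hsub
  refine ⟨i, Set.Subset.antisymm hi fun y hy => ?_⟩
  have hspan : vectorSpan ℝ F = vectorSpan ℝ (facet P a b i) := by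
    refine Submodule.eq_of_le_of_finrank_eq (vectorSpan_mono ℝ hi) ?_
    have := h.dim_facet i
    rw [dim] at this hdim
    omega
  obtain ⟨x, hx⟩ := hne
  have hconst : ∀ x' ∈ F, l x' = l x := fun x' hx' => by
    rw [hl] at hx hx'
    exact le_antisymm (hx.2 _ hx'.1) (hx'.2 _ hx.1)
  have h0 := eq_zero_of_mem_vectorSpan hconst
    (hspan ▸ vsub_mem_vectorSpan ℝ hy (hi hx) : y - x ∈ vectorSpan ℝ F)
  rw [map_sub, sub_eq_zero] at h0
  rw [hl] at hx ⊢
  exact ⟨hy.1, fun w hw => h0 ▸ hx.2 w hw⟩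

theorem setOf_isFacet [Finite ι] [FiniteDimensional ℝ E] (h : Description P a b z) :
    {F | IsFacet P F} = Set.range (facet P a b) := by
  ext F
  refine ⟨fun hF => ?_, ?_⟩
  · obtain ⟨i, rfl⟩ := h.exists_eq_facet hF
    exact ⟨i, rfl⟩
  · rintro ⟨i, rfl⟩
    exact h.isFacet_facet i

theorem ncard_setOf_isFacet [Fintype ι] [FiniteDimensional ℝ E] (h : Description P a b z) :
    {F | IsFacet P F}.ncard = Fintype.card ι := by
  rw [h.setOf_isFacet, ← Set.image_univ, Set.ncard_image_of_injective _ h.facet_injective,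
    Set.ncard_univ, Nat.card_eq_fintype_card]

/-- The inequalities that are tight at `x`. -/
noncomputable def tight [Fintype ι] (a : ι → StrongDual ℝ E) (b : ι → ℝ) (x : E) : Finset ι :=
  {i | a i x = b i}

@[simp] theorem mem_tight [Fintype ι] {x : E} {i : ι} : i ∈ tight a b x ↔ a i x = b i := by
  simp [tight]

theorem ncard_facets_through [Fintype ι] [FiniteDimensional ℝ E] (h : Description P a b z)
    {x : E} (hx : x ∈ P) : {F | IsFacet P F ∧ x ∈ F}.ncard = #(tight a b x) := by
  have : {F | IsFacet P F ∧ x ∈ F} = facet P a b '' (tight a b x : Set ι) := by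
    ext F
    refine ⟨fun ⟨hF, hxF⟩ => ?_, ?_⟩
    · obtain ⟨i, rfl⟩ := h.exists_eq_facet hF
      exact ⟨i, by simpa using hxF.2, rfl⟩
    · rintro ⟨i, hi, rfl⟩
      exact ⟨h.isFacet_facet i, hx, by simpa using hi⟩
  rw [this, Set.ncard_image_of_injective _ h.facet_injective, Set.ncard_coe_finset]

end Description

end Polytope

/-! ### Recognizing a complete bipartite graph from its triples. -/

/-- If every edge of a graph forms, together with any third vertex, a triple with exactly two
edges, then the graph is complete bipartite; the parts are the neighbours and the non-neighbours
of any given vertex. -/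
theorem adj_iff_of_triples {ι : Type*} {adj : ι → ι → Prop} (hsymm : ∀ i j, adj i j → adj j i)
    (htriple : ∀ p q i, adj p q → i ≠ p → i ≠ q → (adj i p ↔ ¬ adj i q)) {p i j : ι}
    (hi : ¬ adj i p) : adj i j ↔ adj j p := by
  constructor
  · intro hij
    rcases eq_or_ne i p with rfl | hip
    · exact hsymm _ _ hij
    rcases eq_or_ne j p with rfl | hjp
    · exact absurd hij hi
    have := htriple i j p hij hip.symm hjp.symm
    by_contra hj
    exact hi (hsymm _ _ (this.2 fun h => hj (hsymm _ _ h)))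
  · intro hjp
    rcases eq_or_ne i p with rfl | hip
    · exact hsymm _ _ hjp
    rcases eq_or_ne i j with rfl | hij
    · exact absurd hjp hi
    exact (htriple j p i hjp hij hip).2 hi

theorem not_adj_of_adj_of_adj {ι : Type*} {adj : ι → ι → Prop} (hsymm : ∀ i j, adj i j → adj j i)
    (hirr : ∀ i, ¬ adj i i)
    (htriple : ∀ p q i, adj p q → i ≠ p → i ≠ q → (adj i p ↔ ¬ adj i q)) {p i j : ι}
    (hi : adj i p) (hj : adj j p) : ¬ adj i j := by
  intro hij
  have hpi : p ≠ i := by rintro rfl; exact hirr _ hi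
  have hpj : p ≠ j := by rintro rfl; exact hirr _ hj
  exact (htriple i j p hij hpi hpj).1 (hsymm _ _ hi) (hsymm _ _ hj)

/-! ### Vertices and edges of simple polytopes. -/

namespace Polytope.Description

open Finset Classical Topology

variable {E : Type*} [NormedAddCommGroup E] [NormedSpace ℝ E]
variable {ι : Type*} [Fintype ι] {P : Set E} {a : ι → StrongDual ℝ E} {b : ι → ℝ} {z : E}

/-- A direction killed by all tight functionals can be followed a little both ways inside `P`.
Conversely, all tight inequalities stay tight at the ends of any segment of `P` around `v`, so their
difference is such a direction. -/
theorem mem_extremePoints_iff (h : Description P a b z) {v : E} (hv : v ∈ P) :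
    v ∈ P.extremePoints ℝ ↔ ∀ w ∈ vectorSpan ℝ P, (∀ i ∈ tight a b v, a i w = 0) → w = 0 := by
  constructor
  · intro hext w hw hker
    obtain ⟨ε, hε, hle⟩ := exists_pos_of_lt (a := a) (b := b) v w
    obtain ⟨ε', hε', hle'⟩ := exists_pos_of_lt (a := a) (b := b) v (-w)
    set δ := min ε ε' with hδ
    have hδ0 : 0 < δ := lt_min hε hε'
    have key : ∀ c : ℝ, |c| ≤ δ → v + c • w ∈ P := by
      intro c hc
      refine (h.add_mem_iff hv (Submodule.smul_mem _ _ hw)).2 fun i => ?_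
      rw [map_smul, smul_eq_mul]
      rcases (h.le hv i).lt_or_eq with hlt | heq
      · have h1 := hle i hlt
        have h2 := hle' i hlt
        rw [map_neg] at h2
        have hc1 : c ≤ ε := (le_abs_self c).trans (hc.trans (min_le_left _ _))
        have hc2 : -c ≤ ε' := (neg_le_abs c).trans (hc.trans (min_le_right _ _))
        rcases le_total 0 (a i w) with h3 | h3
        · nlinarith
        · nlinarith
      · rw [hker i (mem_tight.2 heq), heq]
        simp
    have h1 := key δ (abs_of_pos hδ0).le
    have h2 := key (-δ) (by rw [abs_neg, abs_of_pos hδ0])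
    have h3 : v ∈ openSegment ℝ (v + δ • w) (v + (-δ) • w) :=
      ⟨1 / 2, 1 / 2, by norm_num, by norm_num, by norm_num, by module⟩
    have h4 := hext.2 h1 h2 h3
    have h5 : δ • w = 0 := by simpa using h4
    exact (smul_eq_zero.1 h5).resolve_left hδ0.ne'
  · intro hker
    refine ⟨hv, fun x hx y hy hxy => ?_⟩
    obtain ⟨s, t, hs, ht, hst, rfl⟩ := hxy
    have h0 : x - y = 0 := by
      refine hker _ (vsub_mem_vectorSpan ℝ hx hy) fun i hi => ?_
      rw [mem_tight] at hi
      simp only [map_add, map_smul, smul_eq_mul] at hi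
      have h1 := h.le hx i
      have h2 := h.le hy i
      rw [map_sub]
      have h3 : s * (b i - a i x) + t * (b i - a i y) = 0 := by
        have : (s + t) * b i = b i := by rw [hst, one_mul]
        linarith
      have h4 : s * (b i - a i x) = 0 := by
        have e1 := mul_nonneg hs.le (sub_nonneg.2 h1)
        have e2 := mul_nonneg ht.le (sub_nonneg.2 h2)
        linarith
      have h5 : t * (b i - a i y) = 0 := by linarith
      have h6 := (mul_eq_zero.1 h4).resolve_left hs.ne'
      have h7 := (mul_eq_zero.1 h5).resolve_left ht.ne'
      linarith
    rw [sub_eq_zero] at h0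
    subst h0
    rw [← add_smul, hst, one_smul]

theorem eq_of_tight_subset (h : Description P a b z) {v w : E} (hv : v ∈ P.extremePoints ℝ)
    (hw : w ∈ P) (hsub : tight a b v ⊆ tight a b w) : v = w := by
  have := (h.mem_extremePoints_iff hv.1).1 hv (v - w) (vsub_mem_vectorSpan ℝ hv.1 hw) fun i hi => by
    rw [map_sub, mem_tight.1 hi, mem_tight.1 (hsub hi), sub_self]
  exact sub_eq_zero.1 this

theorem exists_pos_of_bounded (h : Description P a b z) (hb : Bornology.IsBounded P) {e : E}
    (he : e ∈ vectorSpan ℝ P) (he0 : e ≠ 0) : ∃ i, 0 < a i e := by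
  by_contra hcon
  push Not at hcon
  obtain ⟨M, hM⟩ := hb.exists_norm_le
  have hmem : ∀ t : ℝ, 0 ≤ t → z + t • e ∈ P := fun t ht =>
    (h.add_mem_iff h.base_mem (Submodule.smul_mem _ _ he)).2 fun i => by
      rw [map_smul, smul_eq_mul]
      have := (h.lt i).le
      nlinarith [mul_nonneg ht (neg_nonneg.2 (hcon i))]
  have hpos : 0 < ‖e‖ := norm_pos_iff.2 he0
  have hM0 : 0 ≤ M := (norm_nonneg _).trans (hM z h.base_mem)
  have h1 := hM _ (hmem ((2 * M + 1) / ‖e‖) (by positivity))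
  have h2 := hM z h.base_mem
  have h3 : ‖((2 * M + 1) / ‖e‖) • e‖ = 2 * M + 1 := by
    rw [norm_smul, Real.norm_of_nonneg (by positivity), div_mul_cancel₀ _ hpos.ne']
  have h4 : ‖((2 * M + 1) / ‖e‖) • e‖ ≤ ‖z + ((2 * M + 1) / ‖e‖) • e‖ + ‖z‖ := by
    have := norm_sub_le (z + ((2 * M + 1) / ‖e‖) • e) z
    rwa [add_sub_cancel_left] at this
  linarith

/-- The direction of the edge that leaves the facet `i` at a vertex. -/
theorem exists_edge_direction [FiniteDimensional ℝ E] (h : Description P a b z) {v : E}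
    (hv : v ∈ P.extremePoints ℝ) (hcard : #(tight a b v) = dim P) {i : ι} (hi : i ∈ tight a b v) :
    ∃ e ∈ vectorSpan ℝ P, a i e = -1 ∧ (∀ j ∈ tight a b v, j ≠ i → a j e = 0) ∧
      ∀ w ∈ vectorSpan ℝ P, (∀ j ∈ tight a b v, j ≠ i → a j w = 0) → w = (-a i w) • e := by
  let T : vectorSpan ℝ P →ₗ[ℝ] (tight a b v → ℝ) :=
    LinearMap.pi fun j => (a j : E →ₗ[ℝ] ℝ).domRestrict (vectorSpan ℝ P)
  have hT : ∀ w j, T w j = a j w := fun w j => rfl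
  have hinj : Function.Injective T := by
    rw [← LinearMap.ker_eq_bot, LinearMap.ker_eq_bot']
    intro w hw
    refine Subtype.ext ((h.mem_extremePoints_iff hv.1).1 hv w w.2 fun j hj => ?_)
    rw [← hT w ⟨j, hj⟩, hw]
    rfl
  -- Simplicity enters here: the number of tight inequalities equals the dimension, so injectivity
  -- gives surjectivity.
  have hsurj : Function.Surjective T := by
    rw [← LinearMap.injective_iff_surjective_of_finrank_eq_finrank]
    · exact hinj
    · rw [Module.finrank_pi, Fintype.card_coe, hcard, dim]
  obtain ⟨e, he⟩ := hsurj fun j => if j = ⟨i, hi⟩ then -1 else 0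
  have he' : ∀ j (hj : j ∈ tight a b v), a j e = if j = i then -1 else 0 := fun j hj => by
    rw [← hT e ⟨j, hj⟩, he]
    simp
  refine ⟨e, e.2, by simpa using he' i hi, fun j hj hji => by simpa [hji] using he' j hj,
    fun w hw hker => ?_⟩
  rw [← sub_eq_zero]
  refine (h.mem_extremePoints_iff hv.1).1 hv _
    (Submodule.sub_mem _ hw (Submodule.smul_mem _ _ e.2)) fun j hj => ?_
  rw [map_sub, map_smul, he' j hj]
  split_ifs with hji
  · subst hji; simp
  · simp [hker j hj hji]

/-- Walking along an edge from a vertex of a simple polytope. -/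
theorem exists_neighbor [FiniteDimensional ℝ E] (h : Description P a b z)
    (hb : Bornology.IsBounded P) (hs : ∀ v ∈ P.extremePoints ℝ, #(tight a b v) = dim P) {v : E}
    (hv : v ∈ P.extremePoints ℝ) {i : ι} (hi : i ∈ tight a b v) :
    ∃ p ∉ tight a b v, ∃ w ∈ P.extremePoints ℝ, tight a b w = insert p ((tight a b v).erase i) := by
  obtain ⟨e, he, hei, hej, huniq⟩ := h.exists_edge_direction hv (hs v hv) hi
  have he0 : e ≠ 0 := by rintro rfl; simp at hei
  obtain ⟨p₀, hp₀⟩ := h.exists_pos_of_bounded hb he he0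
  -- The ratio test: `p` is an inequality first met when moving along `e`.
  obtain ⟨p, hp, hmin⟩ := Finset.exists_min_image {p | 0 < a p e} (fun p => (b p - a p v) / a p e)
    ⟨p₀, by simpa using hp₀⟩
  simp only [Finset.mem_filter, Finset.mem_univ, true_and] at hp hmin
  have hpv : p ∉ tight a b v := fun hpv => by
    rcases eq_or_ne p i with rfl | hpi
    · linarith
    · rw [hej p hpv hpi] at hp
      exact lt_irrefl _ hp
  have hlt : ∀ j ∉ tight a b v, a j v < b j := fun j hj =>
    lt_of_le_of_ne (h.le hv.1 j) fun e => hj (mem_tight.2 e)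
  set t := (b p - a p v) / a p e with ht
  have ht0 : 0 < t := div_pos (by have := hlt p hpv; linarith) hp
  have htp : t * a p e = b p - a p v := div_mul_cancel₀ _ hp.ne'
  have hval : ∀ j, a j (v + t • e) = a j v + t * a j e := fun j => by simp
  have hw : v + t • e ∈ P := (h.add_mem_iff hv.1 (Submodule.smul_mem _ _ he)).2 fun j => by
    rw [map_smul, smul_eq_mul]
    rcases le_or_gt (a j e) 0 with hj | hj
    · have := h.le hv.1 j
      nlinarith [mul_nonneg ht0.le (neg_nonneg.2 hj)]
    · have := hmin j hj
      rw [le_div_iff₀ hj] at this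
      linarith
  have hsub : insert p ((tight a b v).erase i) ⊆ tight a b (v + t • e) := by
    intro j hj
    rw [mem_tight, hval]
    rcases Finset.mem_insert.1 hj with rfl | hj'
    · rw [htp]; ring
    · obtain ⟨hji, hjv⟩ := Finset.mem_erase.1 hj'
      rw [hej j hjv hji, mem_tight.1 hjv]
      ring
  have hext : v + t • e ∈ P.extremePoints ℝ := by
    rw [h.mem_extremePoints_iff hw]
    intro u hu hker
    have hu' := huniq u hu fun j hj hji =>
      hker j (hsub (Finset.mem_insert_of_mem (Finset.mem_erase.2 ⟨hji, hj⟩)))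
    have h1 := hker p (hsub (Finset.mem_insert_self _ _))
    rw [hu', map_smul, smul_eq_mul] at h1
    rw [hu', (mul_eq_zero.1 h1).resolve_right hp.ne', zero_smul]
  -- Simplicity at the new vertex rules out further tight inequalities.
  refine ⟨p, hpv, v + t • e, hext, (Finset.eq_of_subset_of_card_le hsub ?_).symm⟩
  rw [hs _ hext, ← hs v hv, Finset.card_insert_of_notMem fun hmem => hpv (Finset.mem_of_mem_erase hmem),
    Finset.card_erase_add_one hi]

/-- Two vertices that share all but one of the tight inequalities span an edge, and this edge
contains all points at which the shared inequalities are tight. -/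
theorem setOf_tight_eq_segment [FiniteDimensional ℝ E] (h : Description P a b z)
    (hs : ∀ v ∈ P.extremePoints ℝ, #(tight a b v) = dim P) {v w : E}
    (hv : v ∈ P.extremePoints ℝ) (hw : w ∈ P) {i p : ι} (hi : i ∈ tight a b v)
    (hp : p ∉ tight a b v) (htw : tight a b w = insert p ((tight a b v).erase i)) :
    {x ∈ P | ∀ j ∈ (tight a b v).erase i, a j x = b j} = segment ℝ v w := by
  obtain ⟨e, he, hei, hej, huniq⟩ := h.exists_edge_direction hv (hs v hv) hi
  have hline : ∀ x ∈ P, (∀ j ∈ (tight a b v).erase i, a j x = b j) →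
      x = v + (b i - a i x) • e := fun x hx hj => by
    have := huniq (x - v) (vsub_mem_vectorSpan ℝ hx hv.1) fun j hjv hji => by
      rw [map_sub, hj j (Finset.mem_erase.2 ⟨hji, hjv⟩), mem_tight.1 hjv, sub_self]
    rw [map_sub, mem_tight.1 hi, neg_sub] at this
    rw [← this, add_sub_cancel]
  have hwj : ∀ j ∈ (tight a b v).erase i, a j w = b j := fun j hj =>
    mem_tight.1 (htw ▸ Finset.mem_insert_of_mem hj)
  have hwp : a p w = b p := mem_tight.1 (htw ▸ Finset.mem_insert_self _ _)
  have hiw : i ∉ tight a b w := by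
    rw [htw, Finset.mem_insert, not_or]
    exact ⟨fun e => hp (e ▸ hi), Finset.notMem_erase i _⟩
  have hwi : 0 < b i - a i w :=
    sub_pos.2 (lt_of_le_of_ne (h.le hw i) fun e => hiw (mem_tight.2 e))
  have hvp : a p v < b p := lt_of_le_of_ne (h.le hv.1 p) fun e => hp (mem_tight.2 e)
  have hwline := hline w hw hwj
  have hpe : (b i - a i w) * a p e = b p - a p v := by
    have := congrArg (a p) hwline
    rw [map_add, map_smul, smul_eq_mul, hwp] at this
    linarith
  have hpe0 : 0 < a p e := by
    by_contra hcon
    nlinarith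
  refine Set.Subset.antisymm ?_ fun x hx => ?_
  · rintro x ⟨hx, hj⟩
    have hxline := hline x hx hj
    have hx0 : 0 ≤ b i - a i x := sub_nonneg.2 (h.le hx i)
    have hx1 : b i - a i x ≤ b i - a i w := by
      have h1 := h.le hx p
      rw [hxline, map_add, map_smul, smul_eq_mul] at h1
      have h2 : (b i - a i x) * a p e ≤ (b i - a i w) * a p e := by
        rw [hpe]
        linarith
      exact le_of_mul_le_mul_right h2 hpe0
    rw [segment_eq_image']
    refine ⟨(b i - a i x) / (b i - a i w), ⟨by positivity, (div_le_one hwi).2 hx1⟩, ?_⟩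
    have hwv : w - v = (b i - a i w) • e := by
      nth_rewrite 1 [hwline]
      rw [add_sub_cancel_left]
    simp only
    rw [hwv, smul_smul, div_mul_cancel₀ _ hwi.ne', ← hxline]
  · refine ⟨h.convex.segment_subset hv.1 hw hx, fun j hj => ?_⟩
    obtain ⟨s, t, -, -, hst, rfl⟩ := hx
    rw [map_add, map_smul, map_smul, hwj j hj, mem_tight.1 (Finset.mem_of_mem_erase hj), smul_eq_mul,
      smul_eq_mul, ← add_mul, hst, one_mul]

/-- A face that contains two points contains every point at which all inequalities are tight that
are tight at both of them. -/
theorem mem_of_isFace (h : Description P a b z) {F : Set E} (hF : IsFace P F) {v w u : E}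
    (hv : v ∈ F) (hw : w ∈ F) (hu : u ∈ P) (hsub : tight a b v ∩ tight a b w ⊆ tight a b u) :
    u ∈ F := by
  have hFP : F ⊆ P := hF.2.subset
  set x : E := (1 / 2 : ℝ) • v + (1 / 2 : ℝ) • w with hx
  have hxF : x ∈ F := (hF.2.convex h.convex) hv hw (by norm_num) (by norm_num) (by norm_num)
  -- The segment from `u` to the midpoint `x` can be prolonged inside `P`, since whatever is tight
  -- at `x` is tight at `v` and `w`, hence at `u`. As `F` is an extreme set containing `x`, it
  -- contains `u`.
  obtain ⟨ε, hε, hle⟩ := exists_pos_of_lt (a := a) (b := b) x (x - u)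
  have hval : ∀ i, a i x = (a i v + a i w) / 2 := fun i => by
    rw [hx]; simp; ring
  have hy : x + ε • (x - u) ∈ P := (h.add_mem_iff (hFP hxF)
    (Submodule.smul_mem _ _ (vsub_mem_vectorSpan ℝ (hFP hxF) hu))).2 fun i => by
      rw [map_smul, smul_eq_mul]
      rcases (h.le (hFP hxF) i).lt_or_eq with hlt | heq
      · exact (hle i hlt).le
      · have h1 := h.le (hFP hv) i
        have h2 := h.le (hFP hw) i
        have h3 := hval i
        have h4 : i ∈ tight a b u := hsub (Finset.mem_inter.2
          ⟨mem_tight.2 (by linarith), mem_tight.2 (by linarith)⟩)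
        rw [vsub_eq_sub, map_sub, mem_tight.1 h4, heq]
        simp
  have hseg : x ∈ openSegment ℝ u (x + ε • (x - u)) := by
    have h1 : (1 + ε) ≠ 0 := by positivity
    refine ⟨ε / (1 + ε), 1 / (1 + ε), by positivity, by positivity,
      by rw [← add_div, add_comm, div_self h1], ?_⟩
    have : x + ε • (x - u) = (1 + ε) • x - ε • u := by module
    rw [this, smul_sub, smul_smul, smul_smul, one_div, inv_mul_cancel₀ h1, one_smul,
      div_eq_inv_mul]
    abel
  exact hF.2.isExtreme.2 hu hy hxF hseg

/-- There is a vertex at which exactly the inequalities `i` and `j` are not tight. -/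
def coAdj (P : Set E) (a : ι → StrongDual ℝ E) (b : ι → ℝ) (i j : ι) : Prop :=
  i ≠ j ∧ ∃ v ∈ P.extremePoints ℝ, tight a b v = {i, j}ᶜ

theorem coAdj_symm {i j : ι} (hij : coAdj P a b i j) : coAdj P a b j i := by
  obtain ⟨hne, v, hv, ht⟩ := hij
  exact ⟨hne.symm, v, hv, by rw [ht, Finset.pair_comm]⟩

theorem insert_erase_compl_pair {p q i : ι} (hpq : p ≠ q) (hip : i ≠ p) :
    insert p ((({p, q} : Finset ι)ᶜ).erase i) = ({i, q} : Finset ι)ᶜ := by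
  ext x
  simp only [Finset.mem_insert, Finset.mem_erase, Finset.mem_compl, Finset.mem_singleton]
  constructor
  · rintro (rfl | h)
    · exact fun h => h.elim (fun e => hip e.symm) hpq
    · tauto
  · tauto

/-- Leaving facet `i` along an edge at the vertex missing `p` and `q` makes exactly one of `p`, `q`
tight at the other end. Both cannot occur, because the edge would have two different far ends. -/
theorem coAdj_triple [FiniteDimensional ℝ E] (h : Description P a b z)
    (hb : Bornology.IsBounded P) (hs : ∀ v ∈ P.extremePoints ℝ, #(tight a b v) = dim P)
    {p q i : ι} (hpq : coAdj P a b p q) (hip : i ≠ p) (hiq : i ≠ q) :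
    coAdj P a b i p ↔ ¬ coAdj P a b i q := by
  obtain ⟨hne, v, hv, ht⟩ := hpq
  have hi : i ∈ tight a b v := by simp [ht, hip, hiq]
  have hp : p ∉ tight a b v := by simp [ht]
  have hq : q ∉ tight a b v := by simp [ht]
  constructor
  · rintro ⟨-, w, hw, hwt⟩ ⟨-, w', hw', hwt'⟩
    have e1 : tight a b w = insert q ((tight a b v).erase i) := by
      rw [hwt, ht, Finset.pair_comm p q, insert_erase_compl_pair hne.symm hiq]
    have e2 : tight a b w' = insert p ((tight a b v).erase i) := by
      rw [hwt', ht, insert_erase_compl_pair hne hip]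
    have hseg : w ∈ segment ℝ v w' := by
      rw [← h.setOf_tight_eq_segment hs hv hw'.1 hi hp e2,
        h.setOf_tight_eq_segment hs hv hw.1 hi hq e1]
      exact right_mem_segment ℝ v w
    rcases (mem_extremePoints_iff_forall_segment.1 hw).2 _ hv.1 _ hw'.1 hseg with rfl | rfl
    · rw [hwt] at hi; simp at hi
    · have : p ∈ tight a b w' := by rw [e2]; exact Finset.mem_insert_self _ _
      rw [hwt] at this; simp at this
  · intro hcon
    obtain ⟨p', hp', w, hw, hwt⟩ := h.exists_neighbor hb hs hv hi
    rw [ht, Finset.notMem_compl, Finset.mem_insert, Finset.mem_singleton] at hp'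
    rcases hp' with rfl | rfl
    · exact absurd ⟨hiq, w, hw, by rw [hwt, ht, insert_erase_compl_pair hne hip]⟩ hcon
    · exact ⟨hip, w, hw, by
        rw [hwt, ht, Finset.pair_comm, insert_erase_compl_pair hne.symm hiq]⟩

theorem graph_adj_of_tight [FiniteDimensional ℝ E] (h : Description P a b z)
    (hs : ∀ v ∈ P.extremePoints ℝ, #(tight a b v) = dim P) {v w : Vertex P} {p q i : ι}
    (hpq : p ≠ q) (hip : i ≠ p) (hiq : i ≠ q) (hv : tight a b (v : E) = {p, q}ᶜ)
    (hw : tight a b (w : E) = {i, q}ᶜ) : (graph P).Adj v w := by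
  have hi : i ∈ tight a b (v : E) := by simp [hv, hip, hiq]
  refine ⟨?_, ?_⟩
  · rintro rfl
    rw [hw] at hi
    simp at hi
  · rw [← h.setOf_tight_eq_segment hs v.2 w.2.1 hi (p := p) (by simp [hv])
      (by rw [hw, hv, insert_erase_compl_pair hpq hip])]
    exact h.isFace_of_finset _ ⟨v, v.2.1, fun j hj => mem_tight.1 (Finset.mem_of_mem_erase hj)⟩

/-- The vertices of a simple polytope whose number of facets exceeds its dimension by two form a
grid. -/
theorem exists_equiv [FiniteDimensional ℝ E] (h : Description P a b z)
    (hb : Bornology.IsBounded P) (hs : ∀ v ∈ P.extremePoints ℝ, #(tight a b v) = dim P)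
    (hcard : Fintype.card ι = dim P + 2) (v₀ : Vertex P) :
    ∃ (c : ι → Prop) (φ : {i // ¬ c i} × {i // c i} ≃ Vertex P),
      ∀ u, tight a b (φ u : E) = {u.1.1, u.2.1}ᶜ := by
  have hpair : ∀ v : Vertex P, ∃ i j, i ≠ j ∧ tight a b (v : E) = {i, j}ᶜ := by
    intro v
    have h1 : #(tight a b (v : E))ᶜ = 2 := by
      rw [Finset.card_compl, hs v v.2, hcard]
      omega
    obtain ⟨i, j, hij, he⟩ := Finset.card_eq_two.1 h1
    exact ⟨i, j, hij, by rw [← he, compl_compl]⟩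
  obtain ⟨p, q, hpq, -⟩ := hpair v₀
  have hsymm : ∀ i j, coAdj P a b i j → coAdj P a b j i := fun _ _ => coAdj_symm
  have hirr : ∀ i, ¬ coAdj P a b i i := fun i hi => hi.1 rfl
  have htriple : ∀ p q i, coAdj P a b p q → i ≠ p → i ≠ q →
      (coAdj P a b i p ↔ ¬ coAdj P a b i q) := fun _ _ _ => h.coAdj_triple hb hs
  have hex : ∀ u : {i // ¬ coAdj P a b i p} × {i // coAdj P a b i p},
      ∃ v : Vertex P, tight a b (v : E) = {u.1.1, u.2.1}ᶜ := fun u => by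
    obtain ⟨-, v, hv, ht⟩ := (adj_iff_of_triples hsymm htriple u.1.2).2 u.2.2
    exact ⟨⟨v, hv⟩, ht⟩
  choose f hf using hex
  have huniq : ∀ v w : Vertex P, tight a b (v : E) = tight a b (w : E) → v = w := fun v w he =>
    Subtype.ext (h.eq_of_tight_subset v.2 w.2.1 he.le)
  refine ⟨fun i => coAdj P a b i p, Equiv.ofBijective f ⟨fun u u' he => ?_, fun v => ?_⟩, hf⟩
  · have h1 : ({u.1.1, u.2.1} : Finset ι) = {u'.1.1, u'.2.1} := by
      rw [← compl_inj_iff, ← hf, ← hf, he]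
    have h2 : u.1.1 ∈ ({u'.1.1, u'.2.1} : Finset ι) := h1 ▸ Finset.mem_insert_self _ _
    have h3 : u.2.1 ∈ ({u'.1.1, u'.2.1} : Finset ι) := by rw [← h1]; simp
    rw [Finset.mem_insert, Finset.mem_singleton] at h2 h3
    refine Prod.ext (Subtype.ext (h2.resolve_right fun e => u.1.2 ?_))
      (Subtype.ext (h3.resolve_left fun e => u'.1.2 ?_))
    · rw [e]; exact u'.2.2
    · rw [← e]; exact u.2.2
  · obtain ⟨i, j, hij, ht⟩ := hpair v
    have hadj : coAdj P a b i j := ⟨hij, v, v.2, ht⟩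
    by_cases hi : coAdj P a b i p
    · have hj : ¬ coAdj P a b j p := fun hj =>
        not_adj_of_adj_of_adj hsymm hirr htriple hi hj hadj
      exact ⟨(⟨j, hj⟩, ⟨i, hi⟩), huniq _ _ (by rw [hf, ht, Finset.pair_comm])⟩
    · have hj := (adj_iff_of_triples hsymm htriple hi).1 hadj
      exact ⟨(⟨i, hi⟩, ⟨j, hj⟩), huniq _ _ (by rw [hf, ht])⟩

end Polytope.Description

/-! ### The grid of the polytope and its orientation. -/

namespace Polytope

open Finset Classical

variable {E : Type*} [NormedAddCommGroup E] [NormedSpace ℝ E]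

theorem IsUniqueSinkOrientation.not_rel_self {P : Set E} {R : Vertex P → Vertex P → Prop}
    (hR : IsUniqueSinkOrientation P R) (v : Vertex P) : ¬ R v v := fun h =>
  (graph P).loopless.irrefl v (hR.1.1 v v h)

variable [FiniteDimensional ℝ E]

/-- A unique sink orientation of a simple polytope whose number of facets exceeds its dimension by
two is a unique sink orientation of a grid. -/
theorem Description.exists_grid {ι : Type} [Fintype ι] {P : Set E} {a : ι → StrongDual ℝ E}
    {b : ι → ℝ} {z : E} (h : Description P a b z) (hb : Bornology.IsBounded P)
    (hs : ∀ v ∈ P.extremePoints ℝ, #(Description.tight a b v) = dim P)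
    (hcard : Fintype.card ι = dim P + 2) {R : Vertex P → Vertex P → Prop}
    (hR : IsUniqueSinkOrientation P R) (v₀ : Vertex P) :
    ∃ (α β : Type) (_ : Fintype α) (_ : Fintype β) (G : GridOrientation α β) (φ : α × β ≃ Vertex P),
      G.IsUSO ∧ (∀ u w, R (φ u) (φ w) ↔ G.Step u w) ∧
        Fintype.card α ≤ dim P + 2 ∧ Fintype.card β ≤ dim P + 2 := by
  obtain ⟨c, φ, hφ⟩ := h.exists_equiv hb hs hcard v₀
  have hne : ∀ (i : {i // ¬ c i}) (j : {i // c i}), i.1 ≠ j.1 := fun i j e => i.2 (e ▸ j.2)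
  have hcol : ∀ i i' j, i ≠ i' → (graph P).Adj (φ (i, j)) (φ (i', j)) := fun i i' j hi =>
    h.graph_adj_of_tight hs (hne i j) (fun e => hi (Subtype.ext e.symm)) (hne i' j)
      (hφ (i, j)) (hφ (i', j))
  have hrow : ∀ i j j', j ≠ j' → (graph P).Adj (φ (i, j)) (φ (i, j')) := fun i j j' hj =>
    h.graph_adj_of_tight hs (hne i j).symm (fun e => hj (Subtype.ext e.symm)) (hne i j').symm
      (by rw [hφ (i, j), Finset.pair_comm]) (by rw [hφ (i, j'), Finset.pair_comm])
  -- If two vertices span an edge, that face also contains the grid vertex `(u.1, w.2)`, which must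
  -- be one of the two endpoints.
  have hshare : ∀ u w, (graph P).Adj (φ u) (φ w) → u.1 = w.1 ∨ u.2 = w.2 := by
    intro u w hadj
    have hmem := h.mem_of_isFace hadj.2 (left_mem_segment ℝ _ _) (right_mem_segment ℝ _ _)
      (φ (u.1, w.2)).2.1 (by
        rw [hφ, hφ, hφ]
        intro x
        simp only [Finset.mem_inter, Finset.mem_compl, Finset.mem_insert, Finset.mem_singleton]
        tauto)
    rcases (mem_extremePoints_iff_forall_segment.1 (φ (u.1, w.2)).2).2 _ (φ u).2.1 _ (φ w).2.1 hmem
      with he | he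
    · have := φ.injective (Subtype.ext he)
      exact Or.inr (Prod.ext_iff.1 this).2
    · have := φ.injective (Subtype.ext he)
      exact Or.inl (Prod.ext_iff.1 this).1.symm
  let G : GridOrientation {i // ¬ c i} {i // c i} :=
    ⟨fun j i i' => R (φ (i, j)) (φ (i', j)), fun i j j' => R (φ (i, j)) (φ (i, j'))⟩
  have hstep : ∀ u w, R (φ u) (φ w) ↔ G.Step u w := by
    rintro ⟨i, j⟩ ⟨i', j'⟩
    constructor
    · intro hr
      rcases hshare _ _ (hR.1.1 _ _ hr) with he | he <;> simp only at he <;> subst he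
      · exact Or.inr ⟨rfl, hr⟩
      · exact Or.inl ⟨rfl, hr⟩
    · rintro (⟨he, hr⟩ | ⟨he, hr⟩) <;> simp only at he <;> subst he <;> exact hr
  refine ⟨{i // ¬ c i}, {i // c i}, inferInstance, inferInstance, G, φ, ?_, hstep, ?_, ?_⟩
  · refine ⟨fun j i => hR.not_rel_self _, fun i j => hR.not_rel_self _,
      fun j i i' hi => hR.1.2 _ _ (hcol i i' j hi), fun i j j' hj => hR.1.2 _ _ (hrow i j j' hj), ?_⟩
    rintro A B ⟨i₁, hi₁⟩ ⟨j₁, hj₁⟩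
    -- Requiring tightness for every inequality outside `A` and `B` cuts out a face whose vertices
    -- are exactly the subgrid `A × B`.
    let K : Finset ι := {x | (∀ i ∈ A, i.1 ≠ x) ∧ ∀ j ∈ B, j.1 ≠ x}
    have hmem : ∀ u : {i // ¬ c i} × {i // c i},
        ((φ u : E) ∈ {x ∈ P | ∀ i ∈ K, a i x = b i} ↔ u.1 ∈ A ∧ u.2 ∈ B) := by
      intro u
      have h1 : (φ u : E) ∈ {x ∈ P | ∀ i ∈ K, a i x = b i} ↔ ∀ x ∈ K, x ≠ u.1.1 ∧ x ≠ u.2.1 := by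
        rw [Set.mem_ofPred_eq, and_iff_right (φ u).2.1]
        refine forall₂_congr fun x _ => ?_
        rw [← Description.mem_tight (a := a) (b := b), hφ]
        simp
      rw [h1]
      constructor
      · intro hK
        constructor
        · by_contra hu
          refine (hK u.1.1 (Finset.mem_filter.2 ⟨Finset.mem_univ _, fun i hi e => hu ?_,
            fun j _ => (hne u.1 j).symm⟩)).1 rfl
          rwa [← Subtype.ext e]
        · by_contra hu
          refine (hK u.2.1 (Finset.mem_filter.2 ⟨Finset.mem_univ _, fun i _ => hne i u.2,
            fun j hj e => hu ?_⟩)).2 rfl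
          rwa [← Subtype.ext e]
      · rintro ⟨h2, h3⟩ x hx
        have h4 := (Finset.mem_filter.1 hx).2
        exact ⟨(h4.1 _ h2).symm, (h4.2 _ h3).symm⟩
    obtain ⟨v, ⟨hv1, hv2⟩, hv⟩ := hR.2 _ (h.isFace_of_finset K ⟨φ (i₁, j₁), (hmem (i₁, j₁)).2 ⟨hi₁, hj₁⟩⟩)
    obtain ⟨u, rfl⟩ := φ.surjective v
    have hu := (hmem u).1 hv1
    refine ⟨u, ⟨hu, fun x hx => ?_, fun y hy => ?_⟩, ?_⟩
    · exact hv2 (φ (x, u.2)) ((hmem (x, u.2)).2 ⟨hx, hu.2⟩)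
    · exact hv2 (φ (u.1, y)) ((hmem (u.1, y)).2 ⟨hu.1, hy⟩)
    · rintro u' ⟨hu', hs1, hs2⟩
      refine φ.injective (hv _ ⟨(hmem u').2 hu', fun w hw hr => ?_⟩)
      obtain ⟨w, rfl⟩ := φ.surjective w
      have hw' := (hmem w).1 hw
      rcases (hstep _ _).1 hr with ⟨-, h1⟩ | ⟨-, h1⟩
      · exact hs1 _ hw'.1 h1
      · exact hs2 _ hw'.2 h1
  · rw [← hcard]; exact Fintype.card_subtype_le _
  · rw [← hcard]; exact Fintype.card_subtype_le _

theorem exists_grid {P : Set E} (hP : IsPolytope P)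
    (hn : {F | IsFacet P F}.ncard = dim P + 2) (hS : IsSimple P) {R : Vertex P → Vertex P → Prop}
    (hR : IsUniqueSinkOrientation P R) (v₀ : Vertex P) :
    ∃ (α β : Type) (_ : Fintype α) (_ : Fintype β) (G : GridOrientation α β) (φ : α × β ≃ Vertex P),
      G.IsUSO ∧ (∀ u w, R (φ u) (φ w) ↔ G.Step u w) ∧
        Fintype.card α ≤ dim P + 2 ∧ Fintype.card β ≤ dim P + 2 := by
  obtain ⟨k, I, a, b, z, h⟩ := exists_description hP ⟨v₀, v₀.2.1⟩
  refine h.exists_grid hP.1 (fun v hv => ?_) ?_ hR v₀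
  · rw [← h.ncard_facets_through hv.1]
    exact hS ⟨v, hv⟩
  · rw [← h.ncard_setOf_isFacet, hn]

end Polytope

/-! ### The bound for the polytope. -/

theorem theorem1 :
    ∃ C : ℝ, ∀ (d n m : ℕ) (P : Set (EuclideanSpace ℝ (Fin m))),
      n = d + 2 →
      Polytope.IsPolytope P →
      Polytope.dim P = d →
      {F | Polytope.IsFacet P F}.ncard = n →
      Polytope.IsSimple P →
      ∀ R : Polytope.Vertex P → Polytope.Vertex P → Prop,
        Polytope.IsUniqueSinkOrientation P R →
        ∀ (v₀ : Polytope.Vertex P) (Ω : Type*) [MeasurableSpace Ω] (μ : Measure Ω)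
          [IsProbabilityMeasure μ] (X : ℕ → Ω → Polytope.Vertex P),
          DirectedWalk.IsDirectedRandomWalk μ R v₀ X →
          ∫⁻ ω, DirectedWalk.stepsToSink R (fun k => X k ω) ∂μ ≤
            ENNReal.ofReal (C * Real.log n ^ 2) := by
  classical
  refine ⟨1410048, fun d n m P hn hP hd hF hS R hR v₀ Ω _ μ _ X hX => ?_⟩
  subst hd
  obtain ⟨α, β, _, _, G, φ, hG, hstep, hα, hβ⟩ := Polytope.exists_grid hP (by rw [hF, hn]) hS hR v₀
  have : Fintype (Polytope.Vertex P) := Fintype.ofEquiv _ φ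
  have hwf : WellFounded fun u w => R w u := by
    refine Subrelation.wf (r := InvImage (fun u w => G.Step w u) φ.symm) (fun {u w} hr => ?_)
      (InvImage.wf _ hG.wellFounded)
    change G.Step (φ.symm w) (φ.symm u)
    rwa [← hstep, φ.apply_symm_apply, φ.apply_symm_apply]
  obtain ⟨E, hE0, hE⟩ := exists_expected_steps hwf
  refine (hX.lintegral_stepsToSink_le hE0 hE).trans (ENNReal.ofReal_le_ofReal ?_)
  have hE' : ∀ u, E (φ u) = if ∃ w, G.Step u w then
      1 + (∑ w with G.Step u w, E (φ w)) / ((Finset.univ.filter (G.Step u)).card : ℝ) else 0 := by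
    intro u
    have h1 : Finset.univ.filter (R (φ u)) = (Finset.univ.filter (G.Step u)).map φ.toEmbedding := by
      ext w
      obtain ⟨w, rfl⟩ := φ.surjective w
      simp [hstep]
    have h2 : (∃ w, R (φ u) w) ↔ ∃ w, G.Step u w := by
      rw [← φ.exists_congr_right]
      simp [hstep]
    rw [hE (φ u), h1, Finset.sum_map, Finset.card_map]
    simp only [h2, Equiv.coe_toEmbedding]
  have hbound := hG.expected_le (E := fun u => E (φ u)) (n := n) hE' (by omega) (by omega) (φ.symm v₀)
  simp only [Equiv.apply_symm_apply] at hbound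
  refine hbound.trans ?_
  -- Since `n ≥ 2`, additive constants are absorbed: both `Nat.log 2 n + 1` and `1 + Real.log n` are
  -- at most `3 * Real.log n`, so the final constant is `9 * 156672`.
  have hlog : (0.6931471803 : ℝ) ≤ Real.log n := by
    refine Real.log_two_gt_d9.le.trans (Real.log_le_log (by norm_num) ?_)
    exact_mod_cast (by omega : 2 ≤ n)
  have hnat : (Nat.log 2 n : ℝ) * Real.log 2 ≤ Real.log n := by
    rw [← Real.log_pow]
    refine Real.log_le_log (by positivity) ?_
    exact_mod_cast Nat.pow_log_le_self 2 (by omega)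
  have h2 := Real.log_two_gt_d9
  have hL : (Nat.log 2 n : ℝ) ≤ 1.5 * Real.log n := by
    have : (0 : ℝ) ≤ Nat.log 2 n := by positivity
    nlinarith
  have h3 : (Nat.log 2 n : ℝ) + 1 ≤ 3 * Real.log n := by linarith
  have h4 : 156672 * (1 + Real.log n) ≤ 156672 * (3 * Real.log n) := by linarith
  calc ((Nat.log 2 n : ℝ) + 1) * (156672 * (1 + Real.log n))
      ≤ (3 * Real.log n) * (156672 * (3 * Real.log n)) :=
        mul_le_mul h3 h4 (by positivity) (by positivity)
    _ = 1410048 * Real.log n ^ 2 := by ring
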